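/- Let $d\ge 1$ and let $f(z)=\prod_{j=1}^d(z-\zeta_j)$ with distinct roots $\zeta_j\in\mathbb C$, $|\zeta_j|<1$. Where $f'(z)\neq 0$ put $$\alpha(z)=\max_{j>1}\left|\frac{f(z)}{f'(z)}\right|\left|\frac{f^{(j)}(z)}{j!\,f'(z)}\right|^{\frac1{j-1}}$$ (so $\alpha=0$ if $d=1$). Let $|z_0|=1+\frac1d$, $w_0=f(z_0)$, $w=w_0/|w_0|$. The $\alpha$-step algorithm started at $z_0$ stops at $z_n$ if $\alpha(z_n)\le 0.1307$; otherwise it performs its $n$-th step by setting $$w_{n+1}=w_n-\frac1{15}\cdot\frac{|f(z_n)|}{\alpha(z_n)}\,w,\qquad z_{n+1}=z_n-\frac{f(z_n)-w_{n+1}}{f'(z_n)}.$$ Then $f'(z_n)\ne0$ for every point $z_n$ that the algorithm produces. Moreover, let $n\ge0$ be such that the $n$-th step is performed, i.e. $\alpha(z_k)>0.1307$ for all $0\le k\le n$. The branch of $f^{-1}$ with $w_0\mapsto z_0$ extends holomorphically to a neighborhood of the segment $[w_0,w_n]$, and there is a maximal $r_n\ge 0$ for which this branch extends holomorphically (hence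 univalently) to the open disk of radius $r_n$ around $w_n$; here $0<r_n<\infty$. The jump $J_n=|w_n-w_{n+1}|$ satisfies $$J_n\ \ge\ \frac{r_n}{66},$$ and $\delta_n=|f(z_n)-w_n|$ satisfies $\delta_n\le 0.0158\cdot\dfrac{|f(z_n)|}{\alpha(z_n)}$. -/

import Mathlib

open Polynomial

noncomputable section

namespace AlphaStep

/-- The Kim-Smale function
`α(z) = max_{j > 1} |f(z)/f'(z)| * |f^(j)(z) / (j! f'(z))|^(1/(j-1))`.
All terms with `j > deg f` vanish, so the supremum runs over finitely many nonzero terms and is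
attained. It is meaningful only where `f'(z) ≠ 0`. -/
def alpha (f : ℂ[X]) (z : ℂ) : ℝ :=
  ⨆ j : {j : ℕ // 1 < j},
    ‖f.eval z / (derivative f).eval z‖ *
      ‖((derivative^[(j : ℕ)]) f).eval z /
          (((j : ℕ).factorial : ℂ) * (derivative f).eval z)‖ ^ (1 / (((j : ℕ) : ℝ) - 1))

/-- Step 2 of the algorithm, acting on the pair `(w_n, z_n)`; `u` is the unit vector `w₀ / |w₀|`:
`w_{n+1} = w_n - (1/15) (|f(z_n)| / α(z_n)) u`, followed by one step of Newton's method for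
`f - w_{n+1}`, i.e. `z_{n+1} = z_n - (f(z_n) - w_{n+1}) / f'(z_n)`. -/
def step (f : ℂ[X]) (u : ℂ) (p : ℂ × ℂ) : ℂ × ℂ :=
  let w' : ℂ := p.1 - ((1 / 15 * (‖f.eval p.2‖ / alpha f p.2) : ℝ) : ℂ) * u
  (w', p.2 - (f.eval p.2 - w') / (derivative f).eval p.2)

/-- The pair `(w_n, z_n)` produced from the starting point `z₀`, with `w₀ = f(z₀)`.
The stopping rule is not built in; see `Reaches`. -/
def iter (f : ℂ[X]) (z₀ : ℂ) (n : ℕ) : ℂ × ℂ :=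
  (step f (f.eval z₀ / (‖f.eval z₀‖ : ℂ)))^[n] (f.eval z₀, z₀)

/-- The guide point `w_n`. -/
def guide (f : ℂ[X]) (z₀ : ℂ) (n : ℕ) : ℂ := (iter f z₀ n).1

/-- The point `z_n`. -/
def point (f : ℂ[X]) (z₀ : ℂ) (n : ℕ) : ℂ := (iter f z₀ n).2

/-- The algorithm continues at `z_n`, i.e. does not stop there: `α(z_n) > 0.1307`. -/
def Continues (f : ℂ[X]) (z₀ : ℂ) (n : ℕ) : Prop := 0.1307 < alpha f (point f z₀ n)

/-- The algorithm started at `z₀` has not stopped before index `n`, so that it produces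
`w_n` and `z_n`. -/
def Reaches (f : ℂ[X]) (z₀ : ℂ) (n : ℕ) : Prop := ∀ k < n, Continues f z₀ k

/-- The jump `J_n = |w_n - w_{n+1}|`. -/
def jump (f : ℂ[X]) (z₀ : ℂ) (n : ℕ) : ℝ := ‖guide f z₀ n - guide f z₀ (n + 1)‖

/-- The error `δ_n = |f(z_n) - w_n|`. -/
def err (f : ℂ[X]) (z₀ : ℂ) (n : ℕ) : ℝ := ‖f.eval (point f z₀ n) - guide f z₀ n‖

/-- `g` is a holomorphic branch of `f⁻¹` on the open set `U`. -/
structure IsInverseBranch (f : ℂ[X]) (U : Set ℂ) (g : ℂ → ℂ) : Prop where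
  isOpen : IsOpen U
  differentiableOn : DifferentiableOn ℂ g U
  eval_eq : ∀ y ∈ U, f.eval (g y) = y

/-- A branch of `f⁻¹` is automatically univalent. -/
theorem IsInverseBranch.injOn {f : ℂ[X]} {U : Set ℂ} {g : ℂ → ℂ} (h : IsInverseBranch f U g) :
    Set.InjOn g U := by
  intro a ha b hb hab
  rw [← h.eval_eq a ha, ← h.eval_eq b hb, hab]

/-- The radii `r ≥ 0` such that the branch of `f⁻¹` taking `f(z₀)` to `z₀`, continued along the
segment from `f(z₀)` to `w`, is defined (and univalent) on the open disk `D_r(w)`. -/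
def univalenceRadii (f : ℂ[X]) (z₀ w : ℂ) : Set ℝ :=
  {r | 0 ≤ r ∧ ∃ (U : Set ℂ) (g : ℂ → ℂ), IsInverseBranch f U g ∧
    segment ℝ (f.eval z₀) w ⊆ U ∧ Metric.ball w r ⊆ U ∧ g (f.eval z₀) = z₀}

end AlphaStep

end

/-! Write ρ = |f(z)|/α(z) = |f'(z)|/γ, where γ is Smale's number at z, the least γ with
|f^(j)(z)/(j! f'(z))| ≤ γ^(j-1) for all j ≥ 2. Every quantity in the statement is measured in units
of ρ: the jump is exactly ρ/15, the error is to be at most 0.0158 ρ, and r_n turns out to be at most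
4.4 ρ = 66 (ρ/15).

The upper bound for r_n comes from univalent function theory. If the branch lives on a disk of
radius R around f(z), rescaling turns it into a normalized univalent function on the unit disk whose
inverse is a polynomial. The coefficients b_j of that inverse satisfy |b_j| ≤ 4^(j-1)
(`norm_coeff_le_of_inverse`), which says γ ≤ 4|f'(z)|/R, that is R ≤ 4ρ. The sharp coefficient
bounds are not needed. For j = 2, 3 the area theorem and Bieberbach's inequality suffice. For j ≥ 4
Lagrange inversion with Koebe's bound |x| ≤ 4|g(x)| gives j|b_j| ≤ 4^j.

The rest is an induction on the invariant `Tracks`: z_n has residual at most 0.0158 |f'(z_n)|/γ for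
some admissible γ, and the continued branch takes at w_n a value so near z_n that f is injective on
a disk containing both. The second clause ensures that Newton's method follows the prescribed branch
and not another preimage. Since 1/15 + 0.0158 < 0.0825, the next guide point stays inside the
explicit disk around f(z_n) on which the local inverse exists, and one Newton step restores the
invariant (`GammaBound.newton_step`, `Tracks.step`). At the start, f' ≠ 0 by Gauss–Lucas. -/

namespace AlphaStep
-- Integration over annuli and a lower bound for the energy
open MeasureTheory Metric Set Filter Topology ComplexConjugate

/-- The determinant of `v ↦ p v + q v̄` as a real-linear map of the plane. -/
theorem det_mul_add_mul_conj (p q : ℂ) :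
    (p • (1 : ℂ →L[ℝ] ℂ) + q • (Complex.conjCLE : ℂ →L[ℝ] ℂ)).det = ‖p‖ ^ 2 - ‖q‖ ^ 2 := by
  rw [ContinuousLinearMap.det, ← LinearMap.det_toMatrix Complex.basisOneI, Matrix.det_fin_two]
  simp only [LinearMap.toMatrix_apply, Complex.coe_basisOneI, Complex.coe_basisOneI_repr]
  rw [← Complex.normSq_eq_norm_sq, ← Complex.normSq_eq_norm_sq]
  simp [Complex.normSq_apply]
  ring

theorem integral_circle_eq_circleAverage (G : ℂ → ℝ) (s : ℝ) :
    ∫ θ in Ioo (-Real.pi) Real.pi, G (circleMap 0 s θ) =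
      2 * Real.pi * Real.circleAverage G 0 s := by
  rw [Real.circleAverage_eq_integral_add (-Real.pi),
    intervalIntegral.integral_comp_add_right (fun θ => G (circleMap 0 s θ)),
    ← integral_Ioc_eq_integral_Ioo, ← intervalIntegral.integral_of_le (by linarith [Real.pi_pos])]
  have : 2 * Real.pi + -Real.pi = Real.pi := by ring
  rw [this, zero_add, smul_eq_mul, mul_inv_cancel_left₀ (by positivity)]

/-- Integration over an annulus by circles. -/
theorem setIntegral_annulus {G : ℂ → ℝ} {a b : ℝ} (ha : 0 < a)
    (hG : ContinuousOn G {x | a ≤ ‖x‖ ∧ ‖x‖ ≤ b}) :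
    ∫ x in {x : ℂ | ‖x‖ ∈ Ioo a b}, G x =
      ∫ s in Ioo a b, s * (2 * Real.pi * Real.circleAverage G 0 s) := by
  have hpi := Real.pi_pos
  have hmeas : MeasurableSet {x : ℂ | ‖x‖ ∈ Ioo a b} := measurableSet_Ioo.preimage measurable_norm
  have hmap : ∀ p : ℝ × ℝ, Complex.polarCoord.symm p = circleMap 0 p.1 p.2 := by
    intro p
    rw [Complex.polarCoord_symm_apply, circleMap, Complex.exp_mul_I]
    simp
  rw [← integral_indicator hmeas, ← Complex.integral_comp_polarCoord_symm]
  have hsub : Ioo a b ×ˢ Ioo (-Real.pi) Real.pi ⊆ polarCoord.target := by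
    intro p hp
    exact ⟨ha.trans hp.1.1, hp.2⟩
  rw [setIntegral_eq_of_subset_of_forall_sdiff_eq_zero (s := Ioo a b ×ˢ Ioo (-Real.pi) Real.pi)
    (polarCoord.open_target.measurableSet) hsub]
  · have hc : ContinuousOn (fun p : ℝ × ℝ => p.1 * G (circleMap 0 p.1 p.2))
        (Icc a b ×ˢ Icc (-Real.pi) Real.pi) := by
      refine continuousOn_fst.mul (hG.comp ?_ ?_)
      · unfold circleMap
        fun_prop
      · intro p hp
        have : 0 ≤ p.1 := ha.le.trans hp.1.1
        simpa [abs_of_nonneg this] using hp.1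
    have hint : IntegrableOn (fun p : ℝ × ℝ => p.1 * G (circleMap 0 p.1 p.2))
        (Ioo a b ×ˢ Ioo (-Real.pi) Real.pi) (volume.prod volume) :=
      (hc.integrableOn_compact (isCompact_Icc.prod isCompact_Icc)).mono_set
        (prod_mono Ioo_subset_Icc_self Ioo_subset_Icc_self)
    rw [← Measure.volume_eq_prod] at hint
    have : ∀ p ∈ Ioo a b ×ˢ Ioo (-Real.pi) Real.pi,
        p.1 • indicator {x : ℂ | ‖x‖ ∈ Ioo a b} G (Complex.polarCoord.symm p) =
          p.1 * G (circleMap 0 p.1 p.2) := by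
      intro p hp
      rw [hmap, indicator_of_mem, smul_eq_mul]
      have : 0 ≤ p.1 := ha.le.trans hp.1.1.le
      simpa [abs_of_nonneg this] using hp.1
    rw [setIntegral_congr_fun (measurableSet_Ioo.prod measurableSet_Ioo) this,
      Measure.volume_eq_prod, setIntegral_prod _ hint]
    refine setIntegral_congr_fun measurableSet_Ioo fun s _ => ?_
    simp only
    rw [integral_const_mul, integral_circle_eq_circleAverage]
  · rintro p ⟨hp, hp'⟩
    rw [hmap, indicator_of_notMem, smul_zero]
    intro h
    apply hp'
    have h0 : 0 < p.1 := hp.1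
    have : p.1 ∈ Ioo a b := by simpa [abs_of_pos h0] using h
    exact ⟨this, hp.2⟩

/-- Lower bound for the area of the image of an annulus under `1 / x + m x`. -/
theorem le_setIntegral_annulus_norm_sq {m : ℂ → ℂ} (hm : DifferentiableOn ℂ m (ball 0 1)) {a b : ℝ}
    (ha : 0 < a) (hab : a ≤ b) (hb : b < 1) :
    Real.pi * ((a ^ 2)⁻¹ - (b ^ 2)⁻¹ + ‖deriv m 0‖ ^ 2 * (b ^ 2 - a ^ 2)) ≤
      ∫ x in {x : ℂ | ‖x‖ ∈ Ioo a b}, ‖-(x ^ 2)⁻¹ + deriv m x‖ ^ 2 := by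
  set β := deriv m 0 with hβ
  have hm' : DifferentiableOn ℂ (deriv m) (ball 0 1) := hm.deriv isOpen_ball
  have hsub : {x : ℂ | a ≤ ‖x‖ ∧ ‖x‖ ≤ b} ⊆ ball 0 1 := fun x hx => by
    simpa using hx.2.trans_lt hb
  have hcomp : IsCompact {x : ℂ | a ≤ ‖x‖ ∧ ‖x‖ ≤ b} := by
    have : {x : ℂ | a ≤ ‖x‖ ∧ ‖x‖ ≤ b} = closedBall 0 b ∩ {x | a ≤ ‖x‖} := by
      ext x; simp [and_comm]
    rw [this]
    exact (isCompact_closedBall _ _).inter_right (isClosed_le continuous_const continuous_norm)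
  have hmc := hm'.continuousOn.mono hsub
  have hne : ∀ x ∈ {x : ℂ | a ≤ ‖x‖ ∧ ‖x‖ ≤ b}, x ≠ 0 := fun x hx =>
    norm_pos_iff.1 (ha.trans_le hx.1)
  have hmeas : MeasurableSet {x : ℂ | ‖x‖ ∈ Ioo a b} := measurableSet_Ioo.preimage measurable_norm
  have hIoo : {x : ℂ | ‖x‖ ∈ Ioo a b} ⊆ {x : ℂ | a ≤ ‖x‖ ∧ ‖x‖ ≤ b} := fun x hx =>
    ⟨hx.1.le, hx.2.le⟩
  -- A minorant of the integrand with computable circle averages: expand the square and replace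
  -- |m'|² by 2 Re(m' β̄) - |β|².
  let G : ℂ → ℝ := fun x => (‖x‖ ^ 4)⁻¹ - ‖β‖ ^ 2 +
    2 * (deriv m x * (conj β - x ^ 2 * (((‖x‖ ^ 4)⁻¹ : ℝ) : ℂ))).re
  have hGc : ContinuousOn G {x : ℂ | a ≤ ‖x‖ ∧ ‖x‖ ≤ b} := by
    have h4 : ContinuousOn (fun x : ℂ => (‖x‖ ^ 4)⁻¹) {x : ℂ | a ≤ ‖x‖ ∧ ‖x‖ ≤ b} :=
      ContinuousOn.inv₀ (by fun_prop) fun x hx => by simpa using hne x hx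
    refine (h4.sub continuousOn_const).add (continuousOn_const.mul
      (Complex.continuous_re.comp_continuousOn (hmc.mul (continuousOn_const.sub
        ((continuousOn_id.pow 2).mul (Complex.continuous_ofReal.comp_continuousOn h4))))))
  have hKc : ContinuousOn (fun x => ‖-(x ^ 2)⁻¹ + deriv m x‖ ^ 2)
      {x : ℂ | a ≤ ‖x‖ ∧ ‖x‖ ≤ b} := by
    have h2 : ContinuousOn (fun x : ℂ => (x ^ 2)⁻¹) {x : ℂ | a ≤ ‖x‖ ∧ ‖x‖ ≤ b} :=
      ContinuousOn.inv₀ (by fun_prop) fun x hx => by simpa using hne x hx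
    exact (h2.neg.add hmc).norm.pow 2
  have hle : ∀ x ∈ {x : ℂ | ‖x‖ ∈ Ioo a b}, G x ≤ ‖-(x ^ 2)⁻¹ + deriv m x‖ ^ 2 := by
    intro x hx
    have hx0 := hne x (hIoo hx)
    have h1 : x ^ 2 * (((‖x‖ ^ 4)⁻¹ : ℝ) : ℂ) = conj ((x ^ 2)⁻¹) := by
      have : ((‖x‖ ^ 4 : ℝ) : ℂ) = x ^ 2 * conj x ^ 2 := by
        rw [← mul_pow, Complex.mul_conj, Complex.normSq_eq_norm_sq]
        push_cast; ring
      have hx1 : conj x ≠ 0 := by simpa using hx0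
      rw [Complex.ofReal_inv, this]
      simp only [map_inv₀, map_pow]
      field_simp
    have h2 : (‖x‖ ^ 4)⁻¹ = ‖(x ^ 2)⁻¹‖ ^ 2 := by
      rw [norm_inv, norm_pow, inv_pow, ← pow_mul]
    simp only [G, h1]
    rw [h2]
    generalize (x ^ 2)⁻¹ = y
    generalize deriv m x = w
    rw [← Complex.normSq_eq_norm_sq, ← Complex.normSq_eq_norm_sq, ← Complex.normSq_eq_norm_sq]
    simp only [Complex.normSq_apply, Complex.mul_re, Complex.sub_re, Complex.sub_im,
      Complex.conj_re, Complex.conj_im, Complex.add_re, Complex.add_im, Complex.neg_re,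
      Complex.neg_im]
    nlinarith [sq_nonneg (w.re - β.re), sq_nonneg (w.im - β.im)]
  have havg : ∀ s ∈ Ioo a b, s * (2 * Real.pi * Real.circleAverage G 0 s) =
      2 * Real.pi * ((s ^ 3)⁻¹ + s * ‖β‖ ^ 2) := by
    intro s hs
    have hs0 : 0 < s := ha.trans hs.1
    have hsb : closedBall (0 : ℂ) |s| ⊆ ball 0 1 := by
      rw [abs_of_pos hs0]
      exact closedBall_subset_ball (hs.2.trans hb)
    -- On |x| = s the conjugate of x⁻² equals x²/s⁴, so the cross term is the real part of a
    -- holomorphic function and the mean value property applies.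
    let h : ℂ → ℂ := fun x => deriv m x * (conj β - x ^ 2 * (((s ^ 4)⁻¹ : ℝ) : ℂ))
    have hd : DifferentiableOn ℂ h (ball 0 1) := hm'.mul (by fun_prop)
    have hav : Real.circleAverage h 0 s = β * conj β := by
      rw [DiffContOnCl.circleAverage]
      · simp [h, hβ]
      · exact (hd.mono hsb).diffContOnCl_ball (by rfl)
    have hsc : ContinuousOn h (sphere 0 s) :=
      hd.continuousOn.mono (sphere_subset_closedBall.trans (by rwa [abs_of_pos hs0] at hsb))
    have hci : CircleIntegrable h 0 s := hsc.circleIntegrable hs0.le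
    have hre : Real.circleAverage (fun x => (h x).re) 0 s = ‖β‖ ^ 2 := by
      have := Complex.reCLM.circleAverage_comp_comm hci
      rw [hav] at this
      rw [← Complex.normSq_eq_norm_sq]
      simpa [Function.comp_def, Complex.mul_conj, Complex.normSq_apply] using this
    have hcongr : Real.circleAverage G 0 s =
        Real.circleAverage (fun x => ((s ^ 4)⁻¹ - ‖β‖ ^ 2) + (2 : ℝ) • (h x).re) 0 s := by
      refine Real.circleAverage_congr_sphere fun x hx => ?_
      have : ‖x‖ = s := by simpa [abs_of_pos hs0] using hx
      simp [G, h, this]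
    have hcr : CircleIntegrable (fun x => (2 : ℝ) • (h x).re) 0 s :=
      ((Complex.continuous_re.comp_continuousOn hsc).const_smul (2 : ℝ)).circleIntegrable hs0.le
    rw [hcongr, Real.circleAverage_fun_add (circleIntegrable_const _ _ _) hcr,
      Real.circleAverage_const, Real.circleAverage_fun_smul, hre, smul_eq_mul]
    field_simp
    ring
  calc _ = ∫ x in {x : ℂ | ‖x‖ ∈ Ioo a b}, G x := by
        rw [setIntegral_annulus ha hGc, setIntegral_congr_fun measurableSet_Ioo havg,
          integral_const_mul, ← integral_Ioc_eq_integral_Ioo,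
          ← intervalIntegral.integral_of_le hab,
          intervalIntegral.integral_eq_sub_of_hasDerivAt
            (f := fun s => -(s ^ 2)⁻¹ / 2 + s ^ 2 / 2 * ‖β‖ ^ 2)]
        · ring
        · intro s hs
          rw [uIcc_of_le hab] at hs
          have hs0 : s ≠ 0 := (ha.trans_le hs.1).ne'
          have h1 := ((hasDerivAt_pow 2 s).fun_inv (pow_ne_zero 2 hs0)).neg.div_const 2
          have h2 := ((hasDerivAt_pow 2 s).div_const 2).mul_const (‖β‖ ^ 2)
          convert! h1.add h2 using 1
          push_cast
          field_simp
        · refine ContinuousOn.intervalIntegrable ?_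
          rw [uIcc_of_le hab]
          refine ContinuousOn.add (ContinuousOn.inv₀ (by fun_prop) ?_) (by fun_prop)
          intro s hs
          exact pow_ne_zero _ (ha.trans_le hs.1).ne'
    _ ≤ _ := setIntegral_mono_on ((hGc.integrableOn_compact hcomp).mono_set hIoo)
        ((hKc.integrableOn_compact hcomp).mono_set hIoo) hmeas hle

end AlphaStep

/-! ### The area theorem -/

namespace AlphaStep
open MeasureTheory Metric Set Filter Topology ComplexConjugate

/-- Upper bound for the energy of an injective holomorphic function whose image under the
real-linear map `w ↦ w - c w̄` lies in a disk. -/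
theorem setIntegral_norm_sq_le_of_injOn {k k' : ℂ → ℂ} {A : Set ℂ} (hA : MeasurableSet A)
    (hk : ∀ x ∈ A, HasDerivAt k (k' x) x) (hinj : InjOn k A)
    (hint : IntegrableOn (fun x => ‖k' x‖ ^ 2) A) {c : ℂ} (hc : ‖c‖ < 1) {R : ℝ} (hR : 0 ≤ R)
    (hle : ∀ x ∈ A, ‖k x - c * conj (k x)‖ ≤ R) :
    (1 - ‖c‖ ^ 2) * ∫ x in A, ‖k' x‖ ^ 2 ≤ Real.pi * R ^ 2 := by
  have hc2 : 0 ≤ 1 - ‖c‖ ^ 2 := by nlinarith [norm_nonneg c]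
  let T : ℂ → ℂ := fun x => k x - c * conj (k x)
  let D : ℂ → ℂ →L[ℝ] ℂ := fun x =>
    k' x • (1 : ℂ →L[ℝ] ℂ) + (-(c * conj (k' x))) • (Complex.conjCLE : ℂ →L[ℝ] ℂ)
  have hT : ∀ x ∈ A, HasFDerivWithinAt T (D x) A x := by
    intro x hx
    have h1 : HasFDerivAt k ((ContinuousLinearMap.toSpanSingleton ℂ (k' x)).restrictScalars ℝ) x :=
      (hk x hx).hasFDerivAt.restrictScalars ℝ
    have h2 := (Complex.conjCLE : ℂ →L[ℝ] ℂ).hasFDerivAt.comp x h1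
    have h3 := h1.sub (h2.const_mul c)
    refine HasFDerivAt.hasFDerivWithinAt ?_
    convert! h3 using 1
    ext
    simp [D]
    ring

  have hTinj : InjOn T A := by
    intro x hx y hy hxy
    apply hinj hx hy
    have h : k x - k y = c * conj (k x - k y) := by
      rw [map_sub]
      have h0 : k x - c * conj (k x) = k y - c * conj (k y) := hxy
      linear_combination h0
    have h2 : ‖k x - k y‖ = ‖c‖ * ‖k x - k y‖ := by
      conv_lhs => rw [h]
      rw [norm_mul, Complex.norm_conj]
    have : ‖k x - k y‖ = 0 := by nlinarith [norm_nonneg (k x - k y)]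
    exact sub_eq_zero.1 (norm_eq_zero.1 this)
  have hdet : ∀ x, |(D x).det| = (1 - ‖c‖ ^ 2) * ‖k' x‖ ^ 2 := by
    intro x
    have : (D x).det = (1 - ‖c‖ ^ 2) * ‖k' x‖ ^ 2 := by
      rw [det_mul_add_mul_conj, norm_neg, norm_mul, Complex.norm_conj]
      ring
    rw [this, abs_of_nonneg (by positivity)]
  have key := lintegral_abs_det_fderiv_eq_addHaar_image volume hA hT hTinj
  have hsub : T '' A ⊆ closedBall 0 R := by
    rintro _ ⟨x, hx, rfl⟩
    simpa using hle x hx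
  have hvol := measure_mono (μ := volume) hsub
  rw [← key, Complex.volume_closedBall] at hvol
  simp only [hdet] at hvol
  rw [← ofReal_integral_eq_lintegral_ofReal (hint.const_mul _)
    (Eventually.of_forall fun x => by positivity), integral_const_mul] at hvol
  have h3 : ENNReal.ofReal R ^ 2 * (NNReal.pi : ENNReal) = ENNReal.ofReal (Real.pi * R ^ 2) := by
    rw [mul_comm, ENNReal.ofReal_mul Real.pi_pos.le, ENNReal.ofReal_pow hR, ← NNReal.coe_real_pi,
      ENNReal.ofReal_coe_nnreal]
  rw [h3] at hvol
  exact (ENNReal.ofReal_le_ofReal_iff (by positivity)).1 hvol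

/-- The inner circle s = ε is the worst case: 1/ε - 1/s = (s - ε)/(εs), while the other terms grow
by at most (s - ε) times a constant. The B-term vanishes at s = ε, which leaves an excess of order
ε² only. -/
theorem annulus_bound {s ε B C M : ℝ} (hε : 0 < ε) (hs : ε ≤ s) (hs1 : s ≤ 1) (hB : 0 ≤ B)
    (hC : 0 ≤ C) (hM : 0 ≤ M) (hsmall : ε * (2 * B + 2 * C + B * M) ≤ 1) :
    1 / s + B * (s - ε ^ 2 / s) + C * s ^ 2 + B * ε ^ 2 * (M * s) ≤
      1 / ε + (C + B * M) * ε ^ 2 := by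
  have hs0 : 0 < s := hε.trans_le hs
  have hε1 : ε ≤ 1 := hs.trans hs1
  have e1 : 1 / ε - 1 / s = (s - ε) * (1 / (ε * s)) := by field_simp
  have e2 : B * (s - ε ^ 2 / s) = (s - ε) * (B * (1 + ε / s)) := by field_simp; ring
  have h1 : 2 * B + 2 * C + B * M ≤ 1 / (ε * s) := by
    rw [le_div_iff₀ (by positivity)]
    have : 0 ≤ 2 * B + 2 * C + B * M := by positivity
    calc _ = ε * (2 * B + 2 * C + B * M) * s := by ring
      _ ≤ 1 * 1 := mul_le_mul hsmall hs1 hs0.le zero_le_one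
      _ = 1 := one_mul 1
  have h2 : B * (1 + ε / s) ≤ 2 * B := by
    have : ε / s ≤ 1 := (div_le_one hs0).2 hs
    nlinarith
  have h3 : C * (s + ε) ≤ 2 * C := by nlinarith
  have h4 : B * M * ε ^ 2 ≤ B * M := by
    have : ε ^ 2 ≤ 1 := by nlinarith
    have := mul_nonneg hB hM
    nlinarith
  have h5 : B * M * ε ^ 3 ≤ B * M * ε ^ 2 := by
    have := mul_nonneg hB hM
    have : ε ^ 3 ≤ ε ^ 2 := by nlinarith [sq_nonneg ε]
    nlinarith
  have h6 : (s - ε) * (B * (1 + ε / s) + C * (s + ε) + B * M * ε ^ 2) ≤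
      (s - ε) * (1 / (ε * s)) := mul_le_mul_of_nonneg_left (by linarith) (by linarith)
  rw [← e1] at h6
  rw [e2]
  nlinarith

/-- **Area theorem** for a function with a simple pole of residue one at the origin. -/
theorem norm_deriv_le_one_of_injOn {m : ℂ → ℂ} (hm : DifferentiableOn ℂ m (ball 0 1))
    (hinj : InjOn (fun x => x⁻¹ + m x) (ball 0 1 \ {0})) : ‖deriv m 0‖ ≤ 1 := by
  wlog hm0 : m 0 = 0 generalizing m
  · have := this (m := fun x => m x - m 0) (hm.sub_const _) ?_ (by simp)
    · simpa using this
    · intro x hx y hy hxy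
      refine hinj hx hy ?_
      simp only at hxy ⊢
      linear_combination hxy
  set β := deriv m 0 with hβ
  have hball : ball (0 : ℂ) 1 ∈ 𝓝 0 := ball_mem_nhds _ one_pos
  let q := dslope m 0
  have hq : DifferentiableOn ℂ q (ball 0 1) := (Complex.differentiableOn_dslope hball).2 hm
  have hq2 : DifferentiableOn ℂ (dslope q 0) (ball 0 1) :=
    (Complex.differentiableOn_dslope hball).2 hq
  have hmq : ∀ x, m x = x * q x := fun x => by
    have := sub_smul_dslope m 0 x
    simpa [hm0] using this.symm
  have hqq : ∀ x, q x = β + x * dslope q 0 x := fun x => by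
    have := sub_smul_dslope q 0 x
    have h0 : q 0 = β := dslope_same _ _
    rw [h0] at this
    simp only [sub_zero, smul_eq_mul] at this
    rw [this]; ring
  suffices H : ∀ b : ℝ, 0 < b → b < 1 → ‖β‖ * b ^ 2 ≤ 1 by
    have ht : Tendsto (fun b : ℝ => ‖β‖ * b ^ 2) (𝓝[<] 1) (𝓝 (‖β‖ * 1 ^ 2)) :=
      (Continuous.tendsto (by fun_prop) 1).mono_left nhdsWithin_le_nhds
    have := le_of_tendsto ht (by
      filter_upwards [Ioo_mem_nhdsLT (zero_lt_one (α := ℝ))] with b hb using H b hb.1 hb.2)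
    simpa using this
  intro b hb0 hb1
  have hcb : closedBall (0 : ℂ) b ⊆ ball 0 1 := closedBall_subset_ball hb1
  obtain ⟨M, hM⟩ := (isCompact_closedBall (0 : ℂ) b).exists_bound_of_continuousOn
    (hq.continuousOn.mono hcb)
  obtain ⟨C, hC⟩ := (isCompact_closedBall (0 : ℂ) b).exists_bound_of_continuousOn
    (hq2.continuousOn.mono hcb)
  have hM0 : 0 ≤ M := (norm_nonneg _).trans (hM 0 (by simpa using hb0.le))
  have hC0 : 0 ≤ C := (norm_nonneg _).trans (hC 0 (by simpa using hb0.le))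
  have hB0 : 0 ≤ ‖β‖ := norm_nonneg β
  set K := C + ‖β‖ * M with hK
  have hineq : ∀ ε : ℝ, 0 < ε → ε < b → ε * (2 * ‖β‖ + 2 * C + ‖β‖ * M) ≤ 1 →
      ε ^ 2 * ‖β‖ < 1 →
      (1 - ‖β‖ ^ 2 * ε ^ 4) * (- (b ^ 2)⁻¹ + ‖β‖ ^ 2 * (b ^ 2 - ε ^ 2)) ≤
        2 * K * ε + K ^ 2 * ε ^ 4 + ‖β‖ ^ 2 * ε ^ 2 := by
    intro ε hε hεb hsm hc
    set A : Set ℂ := {x : ℂ | ‖x‖ ∈ Ioo ε b} with hA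
    have hAmeas : MeasurableSet A := measurableSet_Ioo.preimage measurable_norm
    have hAb : A ⊆ ball 0 1 \ {0} := fun x hx =>
      ⟨by simpa using hx.2.trans hb1, fun h => by
        have := hx.1
        rw [mem_singleton_iff.1 h, norm_zero] at this
        exact lt_asymm hε this⟩
    have hder : ∀ x ∈ A, HasDerivAt (fun x => x⁻¹ + m x) (-(x ^ 2)⁻¹ + deriv m x) x := by
      intro x hx
      exact (hasDerivAt_inv (hAb hx).2).add
        ((hm.differentiableAt (isOpen_ball.mem_nhds (hAb hx).1)).hasDerivAt)
    have hint : IntegrableOn (fun x => ‖-(x ^ 2)⁻¹ + deriv m x‖ ^ 2) A := by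
      have hcomp : IsCompact (closedBall (0 : ℂ) b ∩ {x | ε ≤ ‖x‖}) :=
        (isCompact_closedBall _ _).inter_right (isClosed_le continuous_const continuous_norm)
      refine IntegrableOn.mono_set (ContinuousOn.integrableOn_compact hcomp ?_)
        (fun x hx => ⟨by simpa using hx.2.le, hx.1.le⟩)
      have h2 : ContinuousOn (fun x : ℂ => (x ^ 2)⁻¹) (closedBall (0 : ℂ) b ∩ {x | ε ≤ ‖x‖}) :=
        ContinuousOn.inv₀ (by fun_prop) fun x hx =>
          pow_ne_zero 2 (norm_pos_iff.1 (hε.trans_le hx.2))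
      exact (h2.neg.add ((hm.deriv isOpen_ball).continuousOn.mono
        (inter_subset_left.trans hcb))).norm.pow 2
    have hcn : ‖β * (ε : ℂ) ^ 2‖ = ‖β‖ * ε ^ 2 := by
      simp
    -- The image of |x| = ε under 1/x + m is nearly an ellipse. As ε²/x̄ = x there, subtracting c
    -- times the conjugate with c = βε² cancels the term βx and makes it a circle up to O(ε²). Then
    -- R² = ε⁻² + O(ε). Without the correction R² would carry a constant error, which would spoil
    -- the limit ε → 0.
    have hup := setIntegral_norm_sq_le_of_injOn (c := β * (ε : ℂ) ^ 2)
      (R := 1 / ε + K * ε ^ 2) hAmeas hder (hinj.mono hAb) hint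
      (by rw [hcn]; linarith) (by positivity) ?_
    · have hlow := le_setIntegral_annulus_norm_sq hm hε hεb.le hb1
      rw [← hβ, ← hA] at hlow
      rw [hcn] at hup
      have h1 : 0 ≤ 1 - (‖β‖ * ε ^ 2) ^ 2 := by
        have : 0 ≤ ‖β‖ * ε ^ 2 := by positivity
        nlinarith
      have h2 := (mul_le_mul_of_nonneg_left hlow h1).trans hup
      have h3 : (1 - (‖β‖ * ε ^ 2) ^ 2) *
          ((ε ^ 2)⁻¹ - (b ^ 2)⁻¹ + ‖β‖ ^ 2 * (b ^ 2 - ε ^ 2)) ≤ (1 / ε + K * ε ^ 2) ^ 2 := by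
        refine le_of_mul_le_mul_left ?_ Real.pi_pos
        linarith
      have e1 : (1 / ε + K * ε ^ 2) ^ 2 = (ε ^ 2)⁻¹ + 2 * K * ε + K ^ 2 * ε ^ 4 := by
        field_simp; ring
      have e2 : (‖β‖ * ε ^ 2) ^ 2 * (ε ^ 2)⁻¹ = ‖β‖ ^ 2 * ε ^ 2 := by
        field_simp
      rw [e1] at h3
      linear_combination h3 + e2
    · intro x hx
      have hx0 : x ≠ 0 := (hAb hx).2
      have hxb : x ∈ closedBall (0 : ℂ) b := by simpa using hx.2.le
      have hs0 : 0 < ‖x‖ := norm_pos_iff.2 hx0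
      have hcx : conj x ≠ 0 := by simpa using hx0
      have hdec : x⁻¹ + m x - β * (ε : ℂ) ^ 2 * conj (x⁻¹ + m x) =
          x⁻¹ + β * (x - (ε : ℂ) ^ 2 / conj x) + dslope q 0 x * x ^ 2 -
            β * (ε : ℂ) ^ 2 * conj (m x) := by
        rw [map_add, map_inv₀, hmq x]
        nth_rewrite 1 [hqq x]
        field_simp
        ring
      have hn : ‖x - (ε : ℂ) ^ 2 / conj x‖ = ‖x‖ - ε ^ 2 / ‖x‖ := by
        have : x - (ε : ℂ) ^ 2 / conj x = ((‖x‖ ^ 2 - ε ^ 2 : ℝ) : ℂ) / conj x := by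
          rw [eq_div_iff hcx, sub_mul, div_mul_cancel₀ _ hcx, Complex.mul_conj,
            Complex.normSq_eq_norm_sq]
          push_cast; ring
        rw [this, norm_div, Complex.norm_conj, Complex.norm_real, Real.norm_of_nonneg]
        · field_simp
        · nlinarith [hx.1]
      rw [hdec]
      calc _ ≤ ‖x⁻¹‖ + ‖β * (x - (ε : ℂ) ^ 2 / conj x)‖ + ‖dslope q 0 x * x ^ 2‖ +
            ‖β * (ε : ℂ) ^ 2 * conj (m x)‖ :=
            (norm_sub_le _ _).trans (add_le_add_left (norm_add₃_le) _)
        _ ≤ 1 / ‖x‖ + ‖β‖ * (‖x‖ - ε ^ 2 / ‖x‖) + C * ‖x‖ ^ 2 + ‖β‖ * ε ^ 2 * (M * ‖x‖) := by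
            rw [norm_inv, norm_mul β, hn, norm_mul, norm_pow, norm_mul, hcn, Complex.norm_conj,
              hmq x, norm_mul, one_div, mul_comm ‖x‖]
            gcongr
            · exact hC x hxb
            · exact hM x hxb
        _ ≤ _ := annulus_bound hε hx.1.le (hx.2.le.trans hb1.le) hB0 hC0 hM0 hsm
  have hlim : Tendsto (fun ε : ℝ => (1 - ‖β‖ ^ 2 * ε ^ 4) *
      (- (b ^ 2)⁻¹ + ‖β‖ ^ 2 * (b ^ 2 - ε ^ 2))) (𝓝[>] 0)
      (𝓝 ((1 - ‖β‖ ^ 2 * 0 ^ 4) * (- (b ^ 2)⁻¹ + ‖β‖ ^ 2 * (b ^ 2 - 0 ^ 2)))) :=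
    (Continuous.tendsto (by fun_prop) 0).mono_left nhdsWithin_le_nhds
  have hlim2 : Tendsto (fun ε : ℝ => 2 * K * ε + K ^ 2 * ε ^ 4 + ‖β‖ ^ 2 * ε ^ 2) (𝓝[>] 0)
      (𝓝 (2 * K * 0 + K ^ 2 * 0 ^ 4 + ‖β‖ ^ 2 * 0 ^ 2)) :=
    (Continuous.tendsto (by fun_prop) 0).mono_left nhdsWithin_le_nhds
  have hev1 : ∀ᶠ ε : ℝ in 𝓝[>] 0, ε * (2 * ‖β‖ + 2 * C + ‖β‖ * M) < 1 := by
    refine (Tendsto.eventually_lt_const (v := 0 * (2 * ‖β‖ + 2 * C + ‖β‖ * M)) (by simp) ?_)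
    exact (Continuous.tendsto (by fun_prop) 0).mono_left nhdsWithin_le_nhds
  have hev2 : ∀ᶠ ε : ℝ in 𝓝[>] 0, ε ^ 2 * ‖β‖ < 1 := by
    refine (Tendsto.eventually_lt_const (v := 0 ^ 2 * ‖β‖) (by simp) ?_)
    exact (Continuous.tendsto (by fun_prop) 0).mono_left nhdsWithin_le_nhds
  have hfin := le_of_tendsto_of_tendsto hlim hlim2 (by
    filter_upwards [hev1, hev2, Ioo_mem_nhdsGT hb0] with ε h1 h2 h3
    exact hineq ε h3.1 h3.2 h1.le h2)
  have h4 : ‖β‖ ^ 2 * b ^ 2 ≤ (b ^ 2)⁻¹ := by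
    norm_num at hfin
    linarith
  have h5 : (‖β‖ * b ^ 2) ^ 2 ≤ 1 := by
    have := mul_le_mul_of_nonneg_right h4 (sq_nonneg b)
    rw [inv_mul_cancel₀ (by positivity)] at this
    nlinarith
  nlinarith [sq_nonneg (‖β‖ * b ^ 2 - 1)]

end AlphaStep

/-! ### Bieberbach's inequality and Koebe's quarter theorem -/

namespace AlphaStep
open MeasureTheory Metric Set Filter Topology ComplexConjugate

/-- A nonvanishing holomorphic function on a disk has a holomorphic square root. -/
theorem exists_sqrt_on_ball {φ : ℂ → ℂ} {r : ℝ} (hr : 0 < r) (hφ : DifferentiableOn ℂ φ (ball 0 r))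
    (h0 : ∀ x ∈ ball (0 : ℂ) r, φ x ≠ 0) (h1 : φ 0 = 1) :
    ∃ σ : ℂ → ℂ, DifferentiableOn ℂ σ (ball 0 r) ∧ σ 0 = 1 ∧ ∀ x ∈ ball (0 : ℂ) r, σ x ^ 2 = φ x := by
  have hd : DifferentiableOn ℂ (fun x => deriv φ x / φ x) (ball 0 r) :=
    (hφ.deriv isOpen_ball).div hφ h0
  -- A primitive L of φ'/φ is a logarithm of φ, because φ exp(-L) is constant; the root is exp(L/2).
  obtain ⟨L, hL0, hL⟩ := hd.isExactOn_ball.with_val_at 0 0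
  refine ⟨fun x => Complex.exp (L x / 2), ?_, by simp [hL0], fun x hx => ?_⟩
  · intro x hx
    exact ((hL x hx).differentiableAt.div_const 2).cexp.differentiableWithinAt
  · have hder : ∀ y ∈ ball (0 : ℂ) r, HasDerivAt (fun x => φ x * Complex.exp (-L x)) 0 y := by
      intro y hy
      have hy' := (hφ.differentiableAt (isOpen_ball.mem_nhds hy)).hasDerivAt
      convert! hy'.mul (hL y hy).neg.cexp using 1
      have := h0 y hy
      field_simp
      simp
    have hc : φ x * Complex.exp (-L x) = φ 0 * Complex.exp (-L 0) :=
      isOpen_ball.is_const_of_deriv_eq_zero (convex_ball (0 : ℂ) r).isPreconnected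
        (fun y hy => (hder y hy).differentiableAt.differentiableWithinAt)
        (fun y hy => (hder y hy).deriv) hx (by simpa using hr)
    rw [h1, hL0, neg_zero, Complex.exp_zero, mul_one, Complex.exp_neg,
      mul_inv_eq_one₀ (Complex.exp_ne_zero _)] at hc
    rw [← Complex.exp_nat_mul, hc]
    congr 1
    push_cast; ring

variable {p : ℂ → ℂ}

theorem one_add_mul_ne_zero_of_injOn (hinj : InjOn (fun x => x * (1 + x * p x)) (ball 0 1))
    {x : ℂ} (hx : x ∈ ball (0 : ℂ) 1) : 1 + x * p x ≠ 0 := by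
  intro h
  have : x = 0 := hinj hx (by simp) (by simp [h])
  simp [this] at h

/-- The area theorem for a normalized univalent function `x + p(0) x² + p'(0) x³ + ⋯`. -/
theorem norm_sq_sub_deriv_le_one (hp : DifferentiableOn ℂ p (ball 0 1))
    (hinj : InjOn (fun x => x * (1 + x * p x)) (ball 0 1)) : ‖p 0 ^ 2 - deriv p 0‖ ≤ 1 := by
  have hφ : DifferentiableOn ℂ (fun x => 1 + x * p x) (ball 0 1) := by fun_prop
  have h0 : ∀ x ∈ ball (0 : ℂ) 1, 1 + x * p x ≠ 0 := fun x hx =>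
    one_add_mul_ne_zero_of_injOn hinj hx
  -- The reciprocal of x(1 + xp) is 1/x + m for this m, and m'(0) = p(0)² - p'(0).
  have hm : DifferentiableOn ℂ (fun x => -p x / (1 + x * p x)) (ball 0 1) := hp.neg.div hφ h0
  have h := norm_deriv_le_one_of_injOn hm ?_
  · have hp0 := (hp.differentiableAt (ball_mem_nhds (0 : ℂ) one_pos)).hasDerivAt
    have hd := hp0.neg.div (((hasDerivAt_id (0 : ℂ)).mul hp0).const_add 1) (by simp)
    have e := hd.deriv
    have e2 : deriv (fun x => -p x / (1 + x * p x)) 0 = p 0 ^ 2 - deriv p 0 := by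
      refine Eq.trans ?_ (e.trans ?_)
      · rfl
      · simp; ring
    rwa [e2] at h
  · intro x hx y hy hxy
    refine hinj hx.1 hy.1 ?_
    have hx0 : x ≠ 0 := hx.2
    have hy0 : y ≠ 0 := hy.2
    have hx1 := h0 x hx.1
    have hy1 := h0 y hy.1
    have key : ∀ z : ℂ, z ≠ 0 → 1 + z * p z ≠ 0 →
        z⁻¹ + -p z / (1 + z * p z) = (z * (1 + z * p z))⁻¹ := by
      intro z hz hz1
      field_simp
      ring
    simp only [key x hx0 hx1, key y hy0 hy1] at hxy
    exact inv_injective hxy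

/-- **Bieberbach's theorem** on the second coefficient. -/
theorem norm_le_two_of_injOn (hp : DifferentiableOn ℂ p (ball 0 1))
    (hinj : InjOn (fun x => x * (1 + x * p x)) (ball 0 1)) : ‖p 0‖ ≤ 2 := by
  have hφ : DifferentiableOn ℂ (fun x => 1 + x * p x) (ball 0 1) := by fun_prop
  obtain ⟨σ, hσ, hσ0, hσ2⟩ := exists_sqrt_on_ball one_pos hφ
    (fun x hx => one_add_mul_ne_zero_of_injOn hinj hx) (by simp)
  have hball : ball (0 : ℂ) 1 ∈ 𝓝 0 := ball_mem_nhds _ one_pos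
  have hτ : DifferentiableOn ℂ (dslope σ 0) (ball 0 1) :=
    (Complex.differentiableOn_dslope hball).2 hσ
  have hστ : ∀ y, σ y = 1 + y * dslope σ 0 y := fun y => by
    have := sub_smul_dslope σ 0 y
    rw [hσ0] at this
    simp only [sub_zero, smul_eq_mul] at this
    rw [this]; ring
  have hsq : MapsTo (fun x : ℂ => x ^ 2) (ball 0 1) (ball 0 1) := by
    intro x hx
    have : ‖x‖ < 1 := by simpa using hx
    simpa using pow_lt_one₀ (norm_nonneg x) this two_ne_zero
  have hτ2 : DifferentiableOn ℂ (fun x => dslope σ 0 (x ^ 2)) (ball 0 1) :=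
    hτ.comp (differentiableOn_id.pow 2) hsq
  -- The odd square root transform: √g(x²) = xσ(x²) = x(1 + xP) with P(x) = x τ(x²), where τ is the
  -- slope of σ at 0. Here P(0) = 0 and P'(0) = σ'(0) = p(0)/2, so the area theorem gives |p(0)|/2 ≤
  -- 1.
  have hP : DifferentiableOn ℂ (fun x => x * dslope σ 0 (x ^ 2)) (ball 0 1) :=
    differentiableOn_id.mul hτ2
  have h := norm_sq_sub_deriv_le_one hP ?_
  · have hd := (hasDerivAt_id (0 : ℂ)).mul
      (hτ2.differentiableAt hball).hasDerivAt
    have e : deriv (fun x => x * dslope σ 0 (x ^ 2)) 0 = deriv σ 0 := by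
      refine Eq.trans ?_ (hd.deriv.trans ?_)
      · rfl
      · simp
    have hσd := (hσ.differentiableAt hball).hasDerivAt
    have hp0 := (hp.differentiableAt hball).hasDerivAt
    have e1 : HasDerivAt (fun x => σ x ^ 2) (2 * deriv σ 0) 0 := by
      convert! hσd.pow 2 using 1
      simp [hσ0]
    have e2 : HasDerivAt (fun x => σ x ^ 2) (p 0) 0 := by
      have h1 : HasDerivAt (fun x => 1 + x * p x) (p 0) 0 := by
        convert! ((hasDerivAt_id (0 : ℂ)).mul hp0).const_add 1 using 1
        simp
      refine h1.congr_of_eventuallyEq ?_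
      filter_upwards [hball] with x hx using hσ2 x hx
    have e3 := e1.unique e2
    rw [e] at h
    rw [← e3, norm_mul]
    simp at h
    norm_num
    exact h
  · have hid : ∀ x : ℂ, x * (1 + x * (x * dslope σ 0 (x ^ 2))) = x * σ (x ^ 2) := by
      intro x
      rw [hστ (x ^ 2)]; ring
    have hne : ∀ x ∈ ball (0 : ℂ) 1, σ (x ^ 2) ≠ 0 := by
      intro x hx h
      have := hσ2 _ (hsq hx)
      simp only [h] at this
      exact one_add_mul_ne_zero_of_injOn hinj (hsq hx) (by simpa using this.symm)
    intro x hx y hy hxy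
    simp only [hid] at hxy
    have h2 : x ^ 2 = y ^ 2 := by
      refine hinj (hsq hx) (hsq hy) ?_
      simp only
      have h3 := congrArg (· ^ 2) hxy
      simp only [mul_pow] at h3
      have hx2 := hσ2 _ (hsq hx)
      have hy2 := hσ2 _ (hsq hy)
      simp only at hx2 hy2
      rwa [hx2, hy2] at h3
    rw [h2] at hxy
    exact mul_right_cancel₀ (hne y hy) hxy

/-- **Koebe's quarter theorem** for a value omitted by a normalized univalent function. -/
theorem one_le_four_mul_norm_of_omitted (hp : DifferentiableOn ℂ p (ball 0 1))
    (hinj : InjOn (fun x => x * (1 + x * p x)) (ball 0 1)) {c : ℂ}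
    (hc : ∀ x ∈ ball (0 : ℂ) 1, x * (1 + x * p x) ≠ c) : 1 ≤ 4 * ‖c‖ := by
  have hc0 : c ≠ 0 := fun h => hc 0 (by simp) (by simp [h])
  have hden : ∀ x ∈ ball (0 : ℂ) 1, 1 - x * (1 + x * p x) / c ≠ 0 := by
    intro x hx h
    apply hc x hx
    field_simp at h
    linear_combination -h
  -- With g omitting c, the function g/(1 - g/c) is again univalent and has second coefficient p(0)
  -- + 1/c.
  have hP : DifferentiableOn ℂ
      (fun x => (p x + (1 + x * p x) / c) / (1 - x * (1 + x * p x) / c)) (ball 0 1) :=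
    DifferentiableOn.div (by fun_prop) (by fun_prop) hden
  have h := norm_le_two_of_injOn hP ?_
  · have h2 := norm_le_two_of_injOn hp hinj
    simp only [zero_mul, add_zero, zero_div, sub_zero, div_one] at h
    have h3 : ‖1 / c‖ ≤ 4 := by
      calc ‖1 / c‖ = ‖(p 0 + 1 / c) - p 0‖ := by congr 1; ring
        _ ≤ _ := norm_sub_le _ _
        _ ≤ 4 := by linarith
    rw [norm_div, norm_one, div_le_iff₀ (norm_pos_iff.2 hc0)] at h3
    exact h3
  · have hid : ∀ x ∈ ball (0 : ℂ) 1,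
        x * (1 + x * ((p x + (1 + x * p x) / c) / (1 - x * (1 + x * p x) / c))) =
          x * (1 + x * p x) / (1 - x * (1 + x * p x) / c) := by
      intro x hx
      rw [eq_div_iff (hden x hx)]
      linear_combination x ^ 2 * div_mul_cancel₀ (p x + (1 + x * p x) / c) (hden x hx)
    intro x hx y hy hxy
    simp only [hid x hx, hid y hy] at hxy
    refine hinj hx hy ?_
    have hx1 := hden x hx
    have hy1 := hden y hy
    simp only
    generalize x * (1 + x * p x) = u at *
    generalize y * (1 + y * p y) = v at *
    rw [div_eq_div_iff hx1 hy1] at hxy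
    field_simp at hxy
    exact mul_right_cancel₀ hc0 (by linear_combination hxy)

/-- The lower bound in Koebe's theorem, on circles. -/
theorem norm_le_four_mul_norm (hp : DifferentiableOn ℂ p (ball 0 1))
    (hinj : InjOn (fun x => x * (1 + x * p x)) (ball 0 1)) {x : ℂ} (hx : x ∈ ball (0 : ℂ) 1) :
    ‖x‖ ≤ 4 * ‖x * (1 + x * p x)‖ := by
  rcases eq_or_ne x 0 with rfl | hx0
  · simp
  have hs0 : 0 < ‖x‖ := norm_pos_iff.2 hx0
  have hs1 : ‖x‖ < 1 := by simpa using hx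
  set s : ℂ := (‖x‖ : ℂ) with hs
  have hsn : ‖s‖ = ‖x‖ := by simp [hs]
  have hs00 : s ≠ 0 := by simpa [hs] using hx0
  have hmaps : MapsTo (fun y : ℂ => s * y) (ball 0 1) (ball 0 1) := by
    intro y hy
    have hy1 : ‖y‖ < 1 := by simpa using hy
    simp only [mem_ball, dist_zero_right, norm_mul, hsn]
    nlinarith [norm_nonneg y]
  have hP : DifferentiableOn ℂ (fun y => s * p (s * y)) (ball 0 1) :=
    (hp.comp (differentiableOn_id.const_mul s) hmaps).const_mul s
  have hid : ∀ y, y * (1 + y * (s * p (s * y))) = s⁻¹ * ((s * y) * (1 + (s * y) * p (s * y))) := by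
    intro y
    field_simp
  -- With s = |x|, the rescaled function g(sy)/s omits g(x)/s on the unit disk: g is injective and
  -- |sy| < |x|.
  have h := one_le_four_mul_norm_of_omitted (c := s⁻¹ * (x * (1 + x * p x))) hP ?_ ?_
  · rw [norm_mul, norm_inv, hsn] at h
    calc ‖x‖ = ‖x‖ * 1 := (mul_one _).symm
      _ ≤ ‖x‖ * (4 * (‖x‖⁻¹ * ‖x * (1 + x * p x)‖)) := by gcongr
      _ = _ := by field_simp
  · intro y hy z hz hyz
    simp only [hid] at hyz
    exact mul_left_cancel₀ hs00
      (hinj (hmaps hy) (hmaps hz) (mul_left_cancel₀ (inv_ne_zero hs00) hyz))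
  · intro y hy h
    rw [hid] at h
    have h1 := hinj (hmaps hy) hx (mul_left_cancel₀ (inv_ne_zero hs00) h)
    have h2 : ‖s * y‖ = ‖x‖ := congrArg norm h1
    have hy1 : ‖y‖ < 1 := by simpa using hy
    rw [norm_mul, hsn] at h2
    nlinarith

end AlphaStep

/-! ### Coefficients of the inverse of a univalent function -/

namespace AlphaStep
open MeasureTheory Metric Set Filter Topology ComplexConjugate

variable {p : ℂ → ℂ}

/-- **Lagrange inversion**: if `F` inverts `g(x) = x (1 + x p(x))`, then the coefficients of `F` are
contour integrals of the negative powers of `g`. -/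
theorem circleIntegral_zpow_neg_eq (hp : DifferentiableOn ℂ p (ball 0 1)) {F : ℂ[X]}
    (hF : ∀ x ∈ ball (0 : ℂ) 1, F.eval (x * (1 + x * p x)) = x)
    (hinj : InjOn (fun x => x * (1 + x * p x)) (ball 0 1)) {s : ℝ} (hs0 : 0 < s) (hs1 : s < 1)
    (j : ℕ) :
    (∮ x in C(0, s), (x * (1 + x * p x)) ^ (-(j : ℤ))) =
      j * (F.coeff j * (2 * Real.pi * Complex.I)) := by
  set G : ℂ → ℂ := fun x => x * (1 + x * p x) with hG
  set φ : ℂ → ℂ := fun x => 1 + x * p x with hφ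
  have hφd : DifferentiableOn ℂ φ (ball 0 1) := by simp only [hφ]; fun_prop
  have hGd : DifferentiableOn ℂ G (ball 0 1) := by simp only [hG]; fun_prop
  have hφ0 : ∀ x ∈ ball (0 : ℂ) 1, φ x ≠ 0 := fun x hx => one_add_mul_ne_zero_of_injOn hinj hx
  have hsph : sphere (0 : ℂ) s ⊆ ball 0 1 :=
    sphere_subset_closedBall.trans (closedBall_subset_ball hs1)
  have hsne : ∀ x ∈ sphere (0 : ℂ) s, x ≠ 0 := fun x hx => ne_of_mem_sphere hx hs0.ne'
  have hG0 : ∀ x ∈ sphere (0 : ℂ) s, G x ≠ 0 := fun x hx =>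
    mul_ne_zero (hsne x hx) (hφ0 x (hsph hx))
  have hGc : ContinuousOn G (sphere 0 s) := hGd.continuousOn.mono hsph
  have hG'c : ContinuousOn (deriv G) (sphere 0 s) :=
    (hGd.deriv isOpen_ball).continuousOn.mono hsph
  have hz : ∀ n : ℤ, ContinuousOn (fun x => G x ^ n) (sphere 0 s) := fun n =>
    hGc.zpow₀ n fun x hx => Or.inl (hG0 x hx)
  have hGder : ∀ x ∈ sphere (0 : ℂ) s, HasDerivAt G (deriv G x) x := fun x hx =>
    (hGd.differentiableAt (isOpen_ball.mem_nhds (hsph hx))).hasDerivAt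
  have hpow : ∀ n : ℤ, ∀ x ∈ sphere (0 : ℂ) s,
      HasDerivAt (fun x => G x ^ n) (n * G x ^ (n - 1) * deriv G x) x := fun n x hx =>
    (hasDerivAt_zpow n (G x) (Or.inl (hG0 x hx))).comp x (hGder x hx)
  have hne : ∀ n : ℤ, n ≠ 0 → (∮ x in C(0, s), deriv G x * G x ^ (n - 1)) = 0 := by
    intro n hn
    refine circleIntegral.integral_eq_zero_of_hasDerivWithinAt (f := fun x => G x ^ n / n) hs0.le
      fun x hx => ?_
    have hn' : (n : ℂ) ≠ 0 := by exact_mod_cast hn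
    refine HasDerivAt.hasDerivWithinAt ?_
    convert! (hpow n x hx).div_const (n : ℂ) using 1
    field_simp
  -- The only power of G whose product with G' is not an exact derivative; the logarithmic
  -- derivative splits as G'/G = 1/x + φ'/φ with a holomorphic second term.
  have heq : (∮ x in C(0, s), deriv G x * G x ^ (-1 : ℤ)) = 2 * Real.pi * Complex.I := by
    have hq : DifferentiableOn ℂ (fun x => deriv φ x / φ x) (ball 0 1) :=
      (hφd.deriv isOpen_ball).div hφd hφ0
    have h0 : (∮ x in C(0, s), deriv φ x / φ x) = 0 :=
      Complex.circleIntegral_eq_zero_of_differentiable_on_off_countable hs0.le countable_empty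
        (hq.continuousOn.mono (closedBall_subset_ball hs1))
        fun x hx => hq.differentiableAt
          (isOpen_ball.mem_nhds (ball_subset_ball hs1.le hx.1))
    have h1 : (∮ x in C(0, s), (x - 0)⁻¹) = 2 * Real.pi * Complex.I :=
      circleIntegral.integral_sub_center_inv 0 hs0.ne'
    suffices hadd : (∮ x in C(0, s), deriv G x * G x ^ (-1 : ℤ)) =
        (∮ x in C(0, s), (x - 0)⁻¹) + ∮ x in C(0, s), deriv φ x / φ x by
      rw [hadd, h0, h1, add_zero]
    rw [← circleIntegral.integral_add]
    · refine circleIntegral.integral_congr hs0.le fun x hx => ?_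
      have hx0 := hsne x hx
      have hφx := hφ0 x (hsph hx)
      have hd : deriv G x = φ x + x * deriv φ x := by
        have := (hasDerivAt_id x).mul
          (hφd.differentiableAt (isOpen_ball.mem_nhds (hsph hx))).hasDerivAt
        refine Eq.trans ?_ (this.deriv.trans ?_)
        · rfl
        · simp
      have hGx : G x = x * φ x := rfl
      simp only [hd, hGx, zpow_neg, zpow_one, sub_zero]
      field_simp
    · exact (ContinuousOn.inv₀ (by fun_prop) fun x hx => by simpa using hsne x hx).circleIntegrable
        hs0.le
    · exact (hq.continuousOn.mono hsph).circleIntegrable hs0.le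
  have hsum : (∮ x in C(0, s), x * (deriv G x * G x ^ (-(j : ℤ) - 1))) =
      F.coeff j * (2 * Real.pi * Complex.I) := by
    have h1 : (∮ x in C(0, s), x * (deriv G x * G x ^ (-(j : ℤ) - 1))) =
        ∮ x in C(0, s), ∑ i ∈ F.support,
          F.coeff i * (deriv G x * G x ^ ((i : ℤ) - j - 1)) := by
      refine circleIntegral.integral_congr hs0.le fun x hx => ?_
      have hGx := hG0 x hx
      have e : x = ∑ i ∈ F.support, F.coeff i * G x ^ i := by
        conv_lhs => rw [← hF x (hsph hx)]
        rw [eval_eq_sum, sum_def]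
      nth_rewrite 1 [e]
      rw [Finset.sum_mul]
      refine Finset.sum_congr rfl fun i _ => ?_
      rw [show (i : ℤ) - j - 1 = i + (-(j : ℤ) - 1) by ring, zpow_add₀ hGx, zpow_natCast]
      ring
    rw [h1, circleIntegral.integral_fun_sum]
    · simp only [circleIntegral.integral_const_mul]
      rw [Finset.sum_eq_single j]
      · rw [sub_self, zero_sub, heq]
      · intro i _ hij
        rw [hne _ (by omega), mul_zero]
      · intro hj
        rw [notMem_support_iff.1 hj, zero_mul]
    · intro i _
      exact (continuousOn_const.mul (hG'c.mul (hz _))).circleIntegrable hs0.le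
  -- Integration by parts: the integrand is the derivative of x G^(-j).
  have hparts : (∮ x in C(0, s), (G x ^ (-(j : ℤ)) -
      j * (x * (deriv G x * G x ^ (-(j : ℤ) - 1))))) = 0 := by
    refine circleIntegral.integral_eq_zero_of_hasDerivWithinAt
      (f := fun x => x * G x ^ (-(j : ℤ))) hs0.le fun x hx => HasDerivAt.hasDerivWithinAt ?_
    convert! (hasDerivAt_id x).mul (hpow (-(j : ℤ)) x hx) using 1
    push_cast
    simp only [id]
    ring
  have hci : CircleIntegrable (fun x => (j : ℂ) * (x * (deriv G x * G x ^ (-(j : ℤ) - 1)))) 0 s :=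
    (continuousOn_const.mul (continuousOn_id.mul (hG'c.mul (hz _)))).circleIntegrable hs0.le
  rw [circleIntegral.integral_sub ((hz _).circleIntegrable hs0.le) hci,
    circleIntegral.integral_const_mul, hsum, sub_eq_zero] at hparts
  exact hparts

/-- Koebe's bound gives |g| ≥ s/4 on |x| = s, hence |g|^(-j) ≤ (4/s)^j in the contour integral; then
s → 1. The factor j on the left is what later saves one power of 4 when j ≥ 4. -/
theorem natCast_mul_norm_coeff_le (hp : DifferentiableOn ℂ p (ball 0 1)) {F : ℂ[X]}
    (hF : ∀ x ∈ ball (0 : ℂ) 1, F.eval (x * (1 + x * p x)) = x)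
    (hinj : InjOn (fun x => x * (1 + x * p x)) (ball 0 1)) (j : ℕ) :
    j * ‖F.coeff j‖ ≤ 4 ^ j := by
  have H : ∀ s : ℝ, 0 < s → s < 1 → j * ‖F.coeff j‖ ≤ s * (4 / s) ^ j := by
    intro s hs0 hs1
    have h := circleIntegral.norm_integral_le_of_norm_le_const (c := 0) (R := s)
      (f := fun x => (x * (1 + x * p x)) ^ (-(j : ℤ))) (C := (4 / s) ^ j) hs0.le ?_
    · rw [circleIntegral_zpow_neg_eq hp hF hinj hs0 hs1] at h
      have hpi := Real.pi_pos
      simp only [norm_mul, Complex.norm_natCast, Complex.norm_I, Complex.norm_ofNat,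
        Complex.norm_real, Real.norm_of_nonneg hpi.le, mul_one] at h
      have : 2 * Real.pi * (j * ‖F.coeff j‖) ≤ 2 * Real.pi * (s * (4 / s) ^ j) := by linarith
      exact le_of_mul_le_mul_left this (by positivity)
    · intro x hx
      have hxs : ‖x‖ = s := by simpa using hx
      have hxb : x ∈ ball (0 : ℂ) 1 := by simpa [hxs] using hs1
      have h1 := norm_le_four_mul_norm hp hinj hxb
      rw [hxs] at h1
      rw [zpow_neg, zpow_natCast, norm_inv, norm_pow, ← inv_pow]
      refine pow_le_pow_left₀ (by positivity) ?_ j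
      have h2 : 0 < ‖x * (1 + x * p x)‖ := by linarith
      rw [inv_le_comm₀ h2 (by positivity), inv_div]
      linarith
  have hlim : Tendsto (fun s : ℝ => s * (4 / s) ^ j) (𝓝[<] 1) (𝓝 (1 * (4 / 1) ^ j)) := by
    refine Tendsto.mono_left ?_ nhdsWithin_le_nhds
    have : ContinuousAt (fun s : ℝ => s * (4 / s) ^ j) 1 :=
      continuousAt_id.mul ((continuousAt_const.div continuousAt_id one_ne_zero).pow j)
    exact this
  have := ge_of_tendsto hlim (by
    filter_upwards [Ioo_mem_nhdsLT (zero_lt_one (α := ℝ))] with s hs using H s hs.1 hs.2)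
  simpa using this

/-- The second and third coefficients of the inverse of `x + p(0) x² + p'(0) x³ + ⋯`. -/
theorem coeff_two_three_of_inverse (hp : DifferentiableOn ℂ p (ball 0 1)) {F : ℂ[X]}
    (hF : ∀ x ∈ ball (0 : ℂ) 1, F.eval (x * (1 + x * p x)) = x) (h0 : F.coeff 0 = 0)
    (h1 : F.coeff 1 = 1) :
    F.coeff 2 = -p 0 ∧ F.coeff 3 = 2 * p 0 ^ 2 - deriv p 0 := by
  have hball : ball (0 : ℂ) 1 ∈ 𝓝 0 := ball_mem_nhds _ one_pos
  set Q := F.divX.divX.divX.divX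
  have hexp : ∀ y, F.eval y = y * (1 + y * (F.coeff 2 + y * (F.coeff 3 + y * Q.eval y))) := by
    intro y
    have e0 : F.eval y = F.divX.eval y * y := by
      conv_lhs => rw [← divX_mul_X_add F]
      simp [h0]
    have e1 : F.divX.eval y = F.divX.divX.eval y * y + 1 := by
      conv_lhs => rw [← divX_mul_X_add F.divX]
      simp [h1]
    have e2 : F.divX.divX.eval y = F.divX.divX.divX.eval y * y + F.coeff 2 := by
      conv_lhs => rw [← divX_mul_X_add F.divX.divX]
      simp
    have e3 : F.divX.divX.divX.eval y = Q.eval y * y + F.coeff 3 := by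
      conv_lhs => rw [← divX_mul_X_add F.divX.divX.divX]
      simp [Q]
    rw [e0, e1, e2, e3]; ring
  set b2 := F.coeff 2
  set b3 := F.coeff 3
  let u : ℂ → ℂ := fun x => 1 + x * p x
  let R : ℂ → ℂ := fun x => b3 + x * u x * Q.eval (x * u x)
  -- This is (F(g(x)) - x)/x² with the division carried out. It vanishes near 0, so H(0) = 0 and
  -- H'(0) = 0 give the two coefficients.
  let H : ℂ → ℂ := fun x => p x + u x ^ 2 * (b2 + x * u x * R x)
  have hpd : HasDerivAt p (deriv p 0) 0 := (hp.differentiableAt hball).hasDerivAt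
  have hu0 : u 0 = 1 := by simp [u]
  have hud : HasDerivAt u (p 0) 0 := by
    convert! ((hasDerivAt_id (0 : ℂ)).mul hpd).const_add 1 using 1
    simp
  have hxu : HasDerivAt (fun x => x * u x) 1 0 := by
    convert! (hasDerivAt_id (0 : ℂ)).mul hud using 1
    simp [hu0]
  have hRd : DifferentiableAt ℂ R 0 := by
    have h2 : DifferentiableAt ℂ (fun x => x * u x) 0 := hxu.differentiableAt
    have h3 : DifferentiableAt ℂ (fun x => Q.eval (x * u x)) 0 :=
      DifferentiableAt.comp (g := fun y => Q.eval y) 0 Q.differentiable.differentiableAt h2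
    exact (h2.mul h3).const_add b3
  have hR0 : R 0 = b3 := by simp [R]
  have hHd : HasDerivAt H (deriv p 0 + (2 * p 0 * b2 + b3)) 0 := by
    have h4 := hpd.add ((hud.pow 2).mul ((hxu.mul hRd.hasDerivAt).const_add b2))
    convert! h4 using 1
    simp [hu0, hR0]
  have hHz : H =ᶠ[𝓝 0] fun _ => (0 : ℂ) := by
    rw [← hHd.continuousAt.eventuallyEq_nhds_iff_eventuallyEq_nhdsNE continuousAt_const]
    filter_upwards [nhdsWithin_le_nhds hball, self_mem_nhdsWithin] with x hx hx0
    have hx0' : x ≠ 0 := hx0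
    have e := hF x hx
    rw [hexp] at e
    have : x ^ 2 * H x = 0 := by
      simp only [H, R, u]
      linear_combination e
    simpa [hx0'] using this
  have hH0 : p 0 + b2 = 0 := by
    have := hHz.eq_of_nhds
    simpa [H, hu0] using this
  have hH1 : deriv p 0 + (2 * p 0 * b2 + b3) = 0 := by
    rw [← hHd.deriv, hHz.deriv_eq]
    simp
  constructor
  · linear_combination hH0
  · linear_combination hH1 - 2 * p 0 * hH0

/-- Bounds for the coefficients of a polynomial with a normalized inverse branch on the unit disk. -/
theorem norm_coeff_le_of_inverse {F : ℂ[X]} {G : ℂ → ℂ} (hG : DifferentiableOn ℂ G (ball 0 1))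
    (hG0 : G 0 = 0) (hF : ∀ x ∈ ball (0 : ℂ) 1, F.eval (G x) = x) (h0 : F.coeff 0 = 0)
    (h1 : F.coeff 1 = 1) {j : ℕ} (hj : 2 ≤ j) : ‖F.coeff j‖ ≤ 4 ^ (j - 1) := by
  have hball : ball (0 : ℂ) 1 ∈ 𝓝 0 := ball_mem_nhds _ one_pos
  have hG1 : deriv G 0 = 1 := by
    have hd := (hG.differentiableAt hball).hasDerivAt
    have hc : HasDerivAt (fun x => F.eval (G x)) (F.derivative.eval (G 0) * deriv G 0) 0 :=
      (F.hasDerivAt (G 0)).comp 0 hd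
    have hid : HasDerivAt (fun x => F.eval (G x)) 1 0 := by
      refine (hasDerivAt_id (0 : ℂ)).congr_of_eventuallyEq ?_
      filter_upwards [hball] with x hx using hF x hx
    have h2 := hc.unique hid
    rw [hG0, ← coeff_zero_eq_eval_zero, coeff_derivative] at h2
    simpa [h1] using h2
  set φ := dslope G 0 with hφ
  have hφd : DifferentiableOn ℂ φ (ball 0 1) := (Complex.differentiableOn_dslope hball).2 hG
  set p := dslope φ 0 with hp
  have hpd : DifferentiableOn ℂ p (ball 0 1) := (Complex.differentiableOn_dslope hball).2 hφd
  have hGp : ∀ x, G x = x * (1 + x * p x) := by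
    intro x
    have e1 := sub_smul_dslope G 0 x
    have e2 := sub_smul_dslope φ 0 x
    have e3 : φ 0 = 1 := by rw [hφ, dslope_same, hG1]
    rw [e3] at e2
    simp only [sub_zero, smul_eq_mul, hG0] at e1 e2
    rw [← e1, hp, e2, ← hφ]; ring
  have hF' : ∀ x ∈ ball (0 : ℂ) 1, F.eval (x * (1 + x * p x)) = x := fun x hx => by
    rw [← hGp, hF x hx]
  have hinj : InjOn (fun x => x * (1 + x * p x)) (ball 0 1) := by
    intro x hx y hy hxy
    simp only at hxy
    rw [← hF' x hx, hxy, hF' y hy]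
  have hp2 := norm_le_two_of_injOn hpd hinj
  -- For j = 2 and j = 3 the bounds obtained are 2 ≤ 4 and 2² + 1 ≤ 16; for j ≥ 4, dividing 4^j by j
  -- gives at most 4^(j-1).
  rcases (show j = 2 ∨ j = 3 ∨ 4 ≤ j by omega) with rfl | rfl | hj4
  · rw [(coeff_two_three_of_inverse hpd hF' h0 h1).1, norm_neg]
    norm_num
    linarith
  · rw [(coeff_two_three_of_inverse hpd hF' h0 h1).2]
    have h3 := norm_sq_sub_deriv_le_one hpd hinj
    calc _ = ‖p 0 ^ 2 + (p 0 ^ 2 - deriv p 0)‖ := by congr 1; ring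
      _ ≤ ‖p 0‖ ^ 2 + ‖p 0 ^ 2 - deriv p 0‖ := by
        rw [← norm_pow]; exact norm_add_le _ _
      _ ≤ 2 ^ 2 + 1 := by gcongr
      _ ≤ _ := by norm_num
  · have h4 := natCast_mul_norm_coeff_le hpd hF' hinj j
    have h5 : (4 : ℝ) ≤ j := by exact_mod_cast hj4
    have h6 : (4 : ℝ) ^ j = 4 * 4 ^ (j - 1) := by
      rw [← pow_succ']; congr 1; omega
    rw [h6] at h4
    have h7 : 4 * ‖F.coeff j‖ ≤ j * ‖F.coeff j‖ := by gcongr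
    linarith

/-- Taylor coefficients of `f` at a point over which an inverse branch is defined on a disk of
radius `R`. -/
theorem norm_taylor_coeff_le_of_branch {f : ℂ[X]} {W z : ℂ} {R : ℝ} (hR : 0 < R) {g : ℂ → ℂ}
    (hg : DifferentiableOn ℂ g (ball W R)) (hgW : g W = z)
    (hfg : ∀ y ∈ ball W R, f.eval (g y) = y) (hf' : f.derivative.eval z ≠ 0) {j : ℕ}
    (hj : 2 ≤ j) :
    ‖(taylor z f).coeff j / f.derivative.eval z‖ ≤ (4 * ‖f.derivative.eval z‖ / R) ^ (j - 1) := by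
  set D := f.derivative.eval z
  have hR' : (R : ℂ) ≠ 0 := by exact_mod_cast hR.ne'
  have hW : f.eval z = W := by rw [← hgW]; exact hfg W (mem_ball_self hR)
  -- Affine normalization y ↦ (f(z + (R/D)y) - W)/R, which fixes 0 with derivative 1 and turns the
  -- disk of radius R around W into the unit disk.
  let F : ℂ[X] := C (R : ℂ)⁻¹ * ((taylor z f).comp (C (R / D) * X) - C W)
  have hcoeff : ∀ i, i ≠ 0 → F.coeff i = (R : ℂ)⁻¹ * ((taylor z f).coeff i * (R / D) ^ i) := by
    intro i hi
    simp only [F]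
    rw [coeff_C_mul, coeff_sub, comp_C_mul_X_coeff, coeff_C_of_ne_zero hi, sub_zero]
  have hmaps : MapsTo (fun x : ℂ => W + R * x) (ball 0 1) (ball W R) := by
    intro x hx
    have : ‖x‖ < 1 := by simpa using hx
    simp only [mem_ball, dist_self_add_left, norm_mul, Complex.norm_real,
      Real.norm_of_nonneg hR.le]
    nlinarith
  let G : ℂ → ℂ := fun x => (g (W + R * x) - z) / (R / D)
  have hG : DifferentiableOn ℂ G (ball 0 1) := by
    refine DifferentiableOn.div_const (DifferentiableOn.sub_const ?_ _) _
    exact hg.comp (by fun_prop) hmaps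
  have h0 : F.coeff 0 = 0 := by
    simp only [F]
    rw [coeff_C_mul, coeff_sub, comp_C_mul_X_coeff, taylor_coeff_zero, hW]
    simp
  have h1 : F.coeff 1 = 1 := by
    rw [hcoeff 1 one_ne_zero, taylor_coeff_one]
    change (R : ℂ)⁻¹ * (D * (R / D) ^ 1) = 1
    field_simp
  have hF : ∀ x ∈ ball (0 : ℂ) 1, F.eval (G x) = x := by
    intro x hx
    simp only [F, G]
    rw [eval_mul, eval_C, eval_sub, eval_C, eval_comp, eval_mul, eval_C, eval_X,
      mul_div_cancel₀ _ (div_ne_zero hR' hf'), taylor_eval, add_comm, add_sub_cancel,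
      hfg _ (hmaps hx)]
    field_simp
    ring
  have h := norm_coeff_le_of_inverse hG (by simp [G, hgW]) hF h0 h1 hj
  rw [hcoeff j (by omega)] at h
  obtain ⟨i, rfl⟩ : ∃ i, j = i + 1 := ⟨j - 1, by omega⟩
  simp only [Nat.add_sub_cancel] at h ⊢
  have e : (taylor z f).coeff (i + 1) / D =
      (R : ℂ)⁻¹ * ((taylor z f).coeff (i + 1) * (R / D) ^ (i + 1)) * (D / R) ^ i := by
    rw [div_pow, div_pow]
    field_simp
    ring
  rw [e, norm_mul, norm_pow, norm_div, Complex.norm_real, Real.norm_of_nonneg hR.le, mul_div_assoc,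
    mul_pow]
  gcongr

end AlphaStep

/-! ### Smale's γ and quantitative Newton estimates -/

namespace AlphaStep
open Metric Set Filter Topology

/-- Smale's `γ(f, z)` is at most `γ`. -/
structure GammaBound (f : ℂ[X]) (z : ℂ) (γ : ℝ) : Prop where
  deriv_ne : f.derivative.eval z ≠ 0
  pos : 0 < γ
  coeff_le : ∀ j, 2 ≤ j → ‖(taylor z f).coeff j‖ ≤ ‖f.derivative.eval z‖ * γ ^ (j - 1)

variable {f : ℂ[X]} {z : ℂ} {γ : ℝ}

theorem taylor_coeff_eq_iterate_derivative (f : ℂ[X]) (z : ℂ) (j : ℕ) :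
    (taylor z f).coeff j = (derivative^[j] f).eval z / (j.factorial : ℂ) := by
  have h : (derivative^[j] f) = j.factorial • hasseDeriv j f := by
    rw [← factorial_smul_hasseDeriv]; rfl
  have : (j.factorial : ℂ) ≠ 0 := by exact_mod_cast j.factorial_ne_zero
  rw [taylor_coeff, h, eval_smul, nsmul_eq_mul, mul_div_cancel_left₀ _ this]

theorem alpha_term_eq (f : ℂ[X]) (z : ℂ) (j : ℕ) :
    (derivative^[j] f).eval z / ((j.factorial : ℂ) * f.derivative.eval z) =
      (taylor z f).coeff j / f.derivative.eval z := by
  rw [taylor_coeff_eq_iterate_derivative, div_div]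

/-- Beyond the degree every term is 0 to a positive power. Boundedness has to be known because a
real supremum over an unbounded family defaults to 0. -/
theorem bddAbove_alpha (f : ℂ[X]) (z : ℂ) :
    BddAbove (range fun j : {j : ℕ // 1 < j} =>
      ‖f.eval z / (derivative f).eval z‖ *
        ‖((derivative^[(j : ℕ)]) f).eval z /
          (((j : ℕ).factorial : ℂ) * (derivative f).eval z)‖ ^ (1 / (((j : ℕ) : ℝ) - 1))) := by
  set t : {j : ℕ // 1 < j} → ℝ := fun j => ‖f.eval z / (derivative f).eval z‖ *
        ‖((derivative^[(j : ℕ)]) f).eval z /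
          (((j : ℕ).factorial : ℂ) * (derivative f).eval z)‖ ^ (1 / (((j : ℕ) : ℝ) - 1)) with ht
  have hfin : (t '' {j | (j : ℕ) ≤ f.natDegree}).Finite :=
    (((finite_le_nat f.natDegree).preimage Subtype.val_injective.injOn)).image t
  refine (hfin.union (finite_singleton 0)).bddAbove.mono ?_
  rintro _ ⟨j, rfl⟩
  by_cases hj : (j : ℕ) ≤ f.natDegree
  · exact Or.inl ⟨j, hj, rfl⟩
  · right
    have h0 : derivative^[(j : ℕ)] f = 0 :=
      iterate_derivative_eq_zero (lt_of_not_ge hj)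
    have hj1 : (1 : ℝ) < (j : ℕ) := by exact_mod_cast j.2
    have : (1 / (((j : ℕ) : ℝ) - 1)) ≠ 0 := one_div_ne_zero (by linarith)
    change t j = 0
    simp only [ht, h0]
    rw [eval_zero, zero_div, norm_zero, Real.zero_rpow this, mul_zero]

theorem rpow_one_div_le_iff {x A : ℝ} (hx : 0 ≤ x) (hA : 0 ≤ A) {j : ℕ} (hj : 1 < j) :
    x ^ (1 / ((j : ℝ) - 1)) ≤ A ↔ x ≤ A ^ (j - 1) := by
  have hj1 : (0 : ℝ) < (j : ℝ) - 1 := by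
    have : (1 : ℝ) < j := by exact_mod_cast hj
    linarith
  rw [one_div, Real.rpow_inv_le_iff_of_pos hx hA hj1, ← Real.rpow_natCast, Nat.cast_sub hj.le,
    Nat.cast_one]

theorem alpha_le {A : ℝ} (hA : 0 ≤ A)
    (h : ∀ j, 2 ≤ j → ‖(taylor z f).coeff j / f.derivative.eval z‖ ≤ A ^ (j - 1)) :
    alpha f z ≤ ‖f.eval z / f.derivative.eval z‖ * A := by
  have : Nonempty {j : ℕ // 1 < j} := ⟨⟨2, by norm_num⟩⟩
  refine ciSup_le fun j => ?_
  refine mul_le_mul_of_nonneg_left ?_ (norm_nonneg _)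
  rw [alpha_term_eq, rpow_one_div_le_iff (norm_nonneg _) hA j.2]
  exact h j j.2

theorem GammaBound.alpha_le (h : GammaBound f z γ) :
    alpha f z ≤ ‖f.eval z / f.derivative.eval z‖ * γ := by
  refine AlphaStep.alpha_le h.pos.le fun j hj => ?_
  rw [norm_div, div_le_iff₀ (norm_pos_iff.2 h.deriv_ne), mul_comm]
  exact h.coeff_le j hj

/-- A `γ` bound exists at every noncritical point. -/
theorem exists_gammaBound (hf' : f.derivative.eval z ≠ 0) : ∃ γ, GammaBound f z γ := by
  -- The summands 1 make B ≥ 1 whenever the bound is needed, so that B ≤ B^(j-1).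
  set B := ∑ j ∈ Finset.range (f.natDegree + 1),
        (1 + ‖(taylor z f).coeff j / f.derivative.eval z‖) with hB
  have hD : 0 < ‖f.derivative.eval z‖ := norm_pos_iff.2 hf'
  have hB0 : 0 < B := Finset.sum_pos (fun i _ => by positivity) ⟨0, by simp⟩
  refine ⟨B, hf', hB0, fun j hj => ?_⟩
  by_cases hjd : j ≤ f.natDegree
  · have h1 : 1 + ‖(taylor z f).coeff j / f.derivative.eval z‖ ≤ B :=
      Finset.single_le_sum (f := fun j => 1 + ‖(taylor z f).coeff j / f.derivative.eval z‖)
        (fun i _ => by positivity) (Finset.mem_range.2 (by omega))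
    have h2 : 1 ≤ B := by linarith [norm_nonneg ((taylor z f).coeff j / f.derivative.eval z)]
    have h3 : ‖(taylor z f).coeff j / f.derivative.eval z‖ ≤ B ^ (j - 1) :=
      calc _ ≤ B := by linarith
        _ = B ^ 1 := (pow_one _).symm
        _ ≤ B ^ (j - 1) := pow_le_pow_right₀ h2 (by omega)
    rw [norm_div, div_le_iff₀ hD] at h3
    linarith
  · rw [coeff_eq_zero_of_natDegree_lt (by rw [natDegree_taylor]; omega), norm_zero]
    positivity

/-- At a zero of f, α is 0; so α > 0 allows division by |f|, which recovers the optimal γ from α =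
|f/f'| γ. -/
theorem gammaBound_of_alpha_pos (hf' : f.derivative.eval z ≠ 0) (hα : 0 < alpha f z) :
    f.eval z ≠ 0 ∧ GammaBound f z (alpha f z * ‖f.derivative.eval z‖ / ‖f.eval z‖) := by
  have hD : 0 < ‖f.derivative.eval z‖ := norm_pos_iff.2 hf'
  have hf : f.eval z ≠ 0 := by
    intro h0
    obtain ⟨γ, hγ⟩ := exists_gammaBound hf'
    have := hγ.alpha_le
    rw [h0, zero_div, norm_zero, zero_mul] at this
    linarith
  have hfn : 0 < ‖f.eval z‖ := norm_pos_iff.2 hf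
  refine ⟨hf, hf', by positivity, fun j hj => ?_⟩
  have h : ‖f.eval z / f.derivative.eval z‖ *
      ‖(taylor z f).coeff j / f.derivative.eval z‖ ^ (1 / ((j : ℝ) - 1)) ≤ alpha f z := by
    rw [← alpha_term_eq]
    exact le_ciSup (bddAbove_alpha f z) ⟨j, hj⟩
  have h2 : ‖(taylor z f).coeff j / f.derivative.eval z‖ ^ (1 / ((j : ℝ) - 1)) ≤
      alpha f z * ‖f.derivative.eval z‖ / ‖f.eval z‖ := by
    rw [norm_div (f.eval z), div_mul_eq_mul_div, div_le_iff₀ hD] at h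
    rw [le_div_iff₀ hfn]
    linarith
  rw [rpow_one_div_le_iff (norm_nonneg _) (by positivity) hj, norm_div, div_le_iff₀ hD] at h2
  linarith

/-- Taylor coefficients at a nearby point. -/
theorem taylor_add_coeff (f : ℂ[X]) (z h : ℂ) (k : ℕ) :
    (taylor (z + h) f).coeff k = ∑ i ∈ Finset.range (f.natDegree + 1),
      ((i + k).choose k : ℂ) * (taylor z f).coeff (i + k) * h ^ i := by
  rw [add_comm, ← taylor_taylor, taylor_coeff, eval_eq_sum_range' (n := f.natDegree + 1)]
  · simp only [hasseDeriv_coeff]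
  · have := natDegree_hasseDeriv_le (taylor z f) k
    rw [natDegree_taylor] at this
    omega

theorem sum_choose_mul_pow_le {t : ℝ} (ht0 : 0 ≤ t) (ht : t < 1) (k N : ℕ) :
    ∑ i ∈ Finset.range N, ((i + k).choose k : ℝ) * t ^ i ≤ 1 / (1 - t) ^ (k + 1) :=
  sum_le_hasSum _ (fun i _ => by positivity)
    (hasSum_choose_mul_geometric_of_norm_lt_one k (by rwa [Real.norm_of_nonneg ht0]))

namespace GammaBound

theorem norm_coeff_mul_pow_le (hg : GammaBound f z γ) {h : ℂ} {t : ℝ} (hh : γ * ‖h‖ ≤ t)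
    {k i : ℕ} (hk : 1 ≤ k) (hki : 2 ≤ i + k) :
    ‖((i + k).choose k : ℂ) * (taylor z f).coeff (i + k) * h ^ i‖ ≤
      ‖f.derivative.eval z‖ * γ ^ (k - 1) * (((i + k).choose k : ℝ) * t ^ i) := by
  have hγ := hg.pos
  rw [norm_mul, norm_mul, Complex.norm_natCast, norm_pow]
  calc _ ≤ ((i + k).choose k : ℝ) * (‖f.derivative.eval z‖ * γ ^ (i + k - 1)) * ‖h‖ ^ i := by
        gcongr
        exact hg.coeff_le _ hki
    _ = ‖f.derivative.eval z‖ * γ ^ (k - 1) * (((i + k).choose k : ℝ) * (γ * ‖h‖) ^ i) := by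
        rw [show i + k - 1 = i + (k - 1) by omega, pow_add, mul_pow]; ring
    _ ≤ _ := by gcongr

/-- Re-expanding at z + h, the geometric majorant of the coefficients turns into the negative
binomial series Σ C(i+k, k) t^i = (1 - t)^(-k-1). -/
theorem norm_taylor_add_coeff_le (hg : GammaBound f z γ) {h : ℂ} {t : ℝ} (ht : t < 1)
    (hh : γ * ‖h‖ ≤ t) {k : ℕ} (hk : 2 ≤ k) :
    ‖(taylor (z + h) f).coeff k‖ ≤
      ‖f.derivative.eval z‖ * γ ^ (k - 1) * (1 / (1 - t) ^ (k + 1)) := by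
  have hγ := hg.pos
  have ht0 : 0 ≤ t := le_trans (by positivity) hh
  rw [taylor_add_coeff]
  calc _ ≤ ∑ i ∈ Finset.range (f.natDegree + 1),
        ‖f.derivative.eval z‖ * γ ^ (k - 1) * (((i + k).choose k : ℝ) * t ^ i) :=
        norm_sum_le_of_le _ fun i _ => hg.norm_coeff_mul_pow_le hh (by omega) (by omega)
    _ = ‖f.derivative.eval z‖ * γ ^ (k - 1) *
        ∑ i ∈ Finset.range (f.natDegree + 1), (((i + k).choose k : ℝ) * t ^ i) := by
        rw [Finset.mul_sum]
    _ ≤ _ := by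
        gcongr
        exact sum_choose_mul_pow_le ht0 ht _ _

theorem norm_derivative_sub_le (hg : GammaBound f z γ) {h : ℂ} {t : ℝ} (ht : t < 1)
    (hh : γ * ‖h‖ ≤ t) :
    ‖f.derivative.eval (z + h) - f.derivative.eval z‖ ≤
      ‖f.derivative.eval z‖ * (1 / (1 - t) ^ 2 - 1) := by
  have hγ := hg.pos
  have ht0 : 0 ≤ t := le_trans (by positivity) hh
  have e : f.derivative.eval (z + h) - f.derivative.eval z =
      ∑ i ∈ Finset.range f.natDegree,
        ((i + 1 + 1).choose 1 : ℂ) * (taylor z f).coeff (i + 1 + 1) * h ^ (i + 1) := by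
    rw [← taylor_coeff_one, taylor_add_coeff, Finset.sum_range_succ', ← taylor_coeff_one]
    simp
  have hs := sum_choose_mul_pow_le ht0 ht 1 (f.natDegree + 1)
  rw [Finset.sum_range_succ'] at hs
  rw [e]
  calc _ ≤ ∑ i ∈ Finset.range f.natDegree,
        ‖f.derivative.eval z‖ * γ ^ (1 - 1) * (((i + 1 + 1).choose 1 : ℝ) * t ^ (i + 1)) :=
        norm_sum_le_of_le _ fun i _ => hg.norm_coeff_mul_pow_le hh le_rfl (by omega)
    _ = ‖f.derivative.eval z‖ *
        ∑ i ∈ Finset.range f.natDegree, (((i + 1 + 1).choose 1 : ℝ) * t ^ (i + 1)) := by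
        rw [← Finset.mul_sum]; simp
    _ ≤ _ := by
        refine mul_le_mul_of_nonneg_left ?_ (norm_nonneg _)
        norm_num at hs ⊢
        linarith

theorem norm_eval_sub_le (hg : GammaBound f z γ) {h : ℂ} {t : ℝ} (ht : t < 1)
    (hh : γ * ‖h‖ ≤ t) :
    ‖f.eval (z + h) - f.eval z - f.derivative.eval z * h‖ ≤
      ‖f.derivative.eval z‖ / γ * (t ^ 2 / (1 - t)) := by
  have hγ := hg.pos
  have ht0 : 0 ≤ t := le_trans (by positivity) hh
  have e : f.eval (z + h) - f.eval z - f.derivative.eval z * h =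
      ∑ i ∈ Finset.range f.natDegree, (taylor z f).coeff (i + 2) * h ^ (i + 2) := by
    have h1 : f.eval (z + h) = (taylor z f).eval h := by rw [taylor_eval, add_comm]
    rw [h1, eval_eq_sum_range' (n := f.natDegree + 2) (by rw [natDegree_taylor]; omega),
      Finset.sum_range_succ', Finset.sum_range_succ', zero_add, taylor_coeff_one, taylor_coeff_zero]
    ring
  have hs := sum_choose_mul_pow_le ht0 ht 0 f.natDegree
  simp only [add_zero, Nat.choose_zero_right, Nat.cast_one, one_mul, zero_add, pow_one] at hs
  rw [e]
  calc _ ≤ ∑ i ∈ Finset.range f.natDegree, ‖f.derivative.eval z‖ / γ * (t ^ 2 * t ^ i) := by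
        refine norm_sum_le_of_le _ fun i _ => ?_
        rw [norm_mul, norm_pow]
        calc _ ≤ ‖f.derivative.eval z‖ * γ ^ (i + 2 - 1) * ‖h‖ ^ (i + 2) := by
              gcongr
              exact hg.coeff_le _ (by omega)
          _ = ‖f.derivative.eval z‖ / γ * (γ * ‖h‖) ^ (i + 2) := by
              rw [show i + 2 - 1 = i + 1 by omega, mul_pow]
              field_simp
              ring
          _ ≤ ‖f.derivative.eval z‖ / γ * t ^ (i + 2) := by gcongr
          _ = _ := by rw [pow_add]; ring
    _ = ‖f.derivative.eval z‖ / γ * (t ^ 2 * ∑ i ∈ Finset.range f.natDegree, t ^ i) := by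
        rw [← Finset.mul_sum, ← Finset.mul_sum]
    _ ≤ ‖f.derivative.eval z‖ / γ * (t ^ 2 * (1 / (1 - t))) := by gcongr
    _ = _ := by ring

theorem mul_norm_sub_lt (hg : GammaBound f z γ) {x : ℂ} {t : ℝ} (hx : x ∈ ball z (t / γ)) :
    γ * ‖x - z‖ < t := by
  rw [mem_ball, dist_eq_norm, lt_div_iff₀ hg.pos] at hx
  linarith

/-- The radius 0.29 lies just below 1 - 1/√2, where 1/(1 - t)² - 1 reaches 1. Up to there f' stays
within |f'(z)| of f'(z), which makes f injective on the disk. -/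
theorem norm_derivative_sub_le_ball (hg : GammaBound f z γ) {x : ℂ}
    (hx : x ∈ ball z (0.29 / γ)) :
    ‖f.derivative.eval x - f.derivative.eval z‖ ≤ 0.984 * ‖f.derivative.eval z‖ := by
  have := hg.norm_derivative_sub_le (h := x - z) (t := 0.29) (by norm_num)
    (hg.mul_norm_sub_lt hx).le
  rw [add_sub_cancel] at this
  have h2 : (1 / (1 - 0.29) ^ 2 - 1 : ℝ) ≤ 0.984 := by norm_num
  nlinarith [norm_nonneg (f.derivative.eval z)]

theorem derivative_ne_zero_of_mem_ball (hg : GammaBound f z γ) {x : ℂ}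
    (hx : x ∈ ball z (0.29 / γ)) : f.derivative.eval x ≠ 0 := by
  intro h0
  have := hg.norm_derivative_sub_le_ball hx
  rw [h0, zero_sub, norm_neg] at this
  linarith [norm_pos_iff.2 hg.deriv_ne]

theorem le_norm_eval_sub (hg : GammaBound f z γ) {x y : ℂ}
    (hx : x ∈ ball z (0.29 / γ)) (hy : y ∈ ball z (0.29 / γ)) :
    0.016 * ‖f.derivative.eval z‖ * ‖x - y‖ ≤ ‖f.eval x - f.eval y‖ := by
  set D := f.derivative.eval z
  have h := (convex_ball z (0.29 / γ)).norm_image_sub_le_of_norm_hasDerivWithin_le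
    (f := fun u => f.eval u - D * u) (f' := fun u => f.derivative.eval u - D)
    (C := 0.984 * ‖D‖)
    (fun u _ => by
      convert! ((f.hasDerivAt u).sub ((hasDerivAt_id u).const_mul D)).hasDerivWithinAt using 1
      simp)
    (fun u hu => hg.norm_derivative_sub_le_ball hu) hy hx
  have e : f.eval x - f.eval y = D * (x - y) + (f.eval x - D * x - (f.eval y - D * y)) := by ring
  rw [e]
  have h1 := norm_sub_le_norm_add (D * (x - y)) (f.eval x - D * x - (f.eval y - D * y))
  rw [norm_mul] at h1
  linarith

theorem injOn_ball (hg : GammaBound f z γ) : InjOn (fun x => f.eval x) (ball z (0.29 / γ)) := by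
  intro x hx y hy hxy
  have h := hg.le_norm_eval_sub hx hy
  have hD := norm_pos_iff.2 hg.deriv_ne
  simp only at hxy
  rw [hxy, sub_self, norm_zero] at h
  have : ‖x - y‖ ≤ 0 := by
    by_contra! hlt
    have : 0 < 0.016 * ‖f.derivative.eval z‖ * ‖x - y‖ := by positivity
    linarith
  exact sub_eq_zero.1 (norm_le_zero_iff.1 this)

theorem le_norm_eval_sub_center (hg : GammaBound f z γ) {x : ℂ} {t : ℝ}
    (ht : t < 1) (hx : γ * ‖x - z‖ = t) :
    ‖f.derivative.eval z‖ / γ * (t - t ^ 2 / (1 - t)) ≤ ‖f.eval x - f.eval z‖ := by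
  have h := hg.norm_eval_sub_le (h := x - z) ht hx.le
  rw [add_sub_cancel] at h
  have h1 := norm_sub_norm_le (f.derivative.eval z * (x - z))
    (-(f.eval x - f.eval z - f.derivative.eval z * (x - z)))
  rw [norm_neg, sub_neg_eq_add, norm_mul] at h1
  have e : f.derivative.eval z * (x - z) + (f.eval x - f.eval z - f.derivative.eval z * (x - z)) =
    f.eval x - f.eval z := by ring
  rw [e] at h1
  have h2 : ‖f.derivative.eval z‖ * ‖x - z‖ = ‖f.derivative.eval z‖ / γ * t := by
    rw [← hx]
    have := hg.pos
    field_simp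
  rw [mul_sub]
  linarith

/-- The local inverse of `f` on an explicit disk around `f z`. -/
theorem exists_branch (hg : GammaBound f z γ) :
    ∃ g : ℂ → ℂ, IsInverseBranch f (ball (f.eval z) (0.0857 * (‖f.derivative.eval z‖ / γ))) g ∧
      MapsTo g (ball (f.eval z) (0.0857 * (‖f.derivative.eval z‖ / γ))) (ball z (0.29 / γ)) := by
  set ρ := ‖f.derivative.eval z‖ / γ with hρ
  have hγ := hg.pos
  have hD := norm_pos_iff.2 hg.deriv_ne
  have hρ0 : 0 < ρ := by positivity
  have hr : 0 < 0.29 / γ := by positivity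
  -- 0.1714 is a lower bound for 0.29 - 0.29²/0.71. The quantitative open mapping theorem used next
  -- loses a factor 2, hence the radius 0.0857.
  have hsph : ∀ x ∈ sphere z (0.29 / γ), 0.1714 * ρ ≤ ‖f.eval x - f.eval z‖ := by
    intro x hx
    have hx' : γ * ‖x - z‖ = 0.29 := by
      rw [mem_sphere, dist_eq_norm] at hx
      rw [hx]; field_simp
    refine le_trans ?_ (hg.le_norm_eval_sub_center (by norm_num) hx')
    rw [← hρ, mul_comm]
    gcongr
    norm_num
  have himg := DiffContOnCl.ball_subset_image_closedBall (f := fun x => f.eval x) (z₀ := z)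
    (f.differentiable.diffContOnCl) hr hsph ?_
  · have hex : ∀ y ∈ ball (f.eval z) (0.0857 * ρ), ∃ x ∈ ball z (0.29 / γ), f.eval x = y := by
      intro y hy
      have hy' : y ∈ ball (f.eval z) (0.1714 * ρ / 2) := by
        rwa [show 0.1714 * ρ / 2 = 0.0857 * ρ by ring]
      obtain ⟨x, hx, hxy⟩ := himg hy'
      refine ⟨x, ?_, hxy⟩
      rcases (mem_closedBall.1 hx).lt_or_eq with hlt | heq
      · exact hlt
      · exfalso
        have h1 := hsph x heq
        simp only at hxy
        rw [hxy, ← dist_eq_norm] at h1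
        have h2 := mem_ball.1 hy
        linarith
    choose! g hg1 hg2 using hex
    refine ⟨g, ⟨isOpen_ball, fun y hy => ?_, hg2⟩, hg1⟩
    have hnhds := isOpen_ball.mem_nhds hy
    have hcont : ContinuousAt g y := by
      rw [Metric.continuousAt_iff']
      intro ε hε
      have hK : 0 < 0.016 * ‖f.derivative.eval z‖ := by positivity
      filter_upwards [hnhds, ball_mem_nhds y (mul_pos hK hε)] with u hu hu2
      have h := hg.le_norm_eval_sub (hg1 u hu) (hg1 y hy)
      rw [hg2 u hu, hg2 y hy, ← dist_eq_norm, ← dist_eq_norm] at h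
      exact lt_of_mul_lt_mul_left (h.trans_lt hu2) hK.le
    refine (HasDerivAt.of_local_left_inverse hcont (f.hasDerivAt (g y))
      (hg.derivative_ne_zero_of_mem_ball (hg1 y hy)) ?_).differentiableAt.differentiableWithinAt
    filter_upwards [hnhds] with u hu using hg2 u hu
  · have hev : ∀ᶠ x in 𝓝[≠] z, f.eval x ≠ f.eval z := by
      filter_upwards [nhdsWithin_le_nhds (ball_mem_nhds z hr), self_mem_nhdsWithin] with x hx hne h
      exact hne (hg.injOn_ball hx (mem_ball_self hr) h)
    exact hev.frequently.filter_mono nhdsWithin_le_nhds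

/-- Preimages of values near `f z` lie near `z`. -/
theorem norm_sub_lt_of_norm_eval_sub_lt (hg : GammaBound f z γ) {x : ℂ}
    (hx : x ∈ ball z (0.29 / γ))
    (hfx : ‖f.eval x - f.eval z‖ ≤ 0.0825 * (‖f.derivative.eval z‖ / γ)) :
    γ * ‖x - z‖ < 0.0925 := by
  by_contra! hge
  have hlt := hg.mul_norm_sub_lt hx
  set t := γ * ‖x - z‖ with ht
  have hρ : 0 < ‖f.derivative.eval z‖ / γ := div_pos (norm_pos_iff.2 hg.deriv_ne) hg.pos
  have h := (hg.le_norm_eval_sub_center (by linarith) ht.symm).trans hfx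
  rw [mul_comm 0.0825] at h
  have h2 := le_of_mul_le_mul_left h hρ
  -- On [0.0925, 0.29] the concave function t - t²/(1 - t) is at least 0.083, above the permitted
  -- 0.0825.
  have h3 : t ^ 2 / (1 - t) ≤ t - 0.083 := by
    rw [div_le_iff₀ (by linarith)]
    nlinarith
  linarith

/-- Control of `γ`, the derivative and the residual after an approximate Newton step. -/
theorem newton_step (hg : GammaBound f z γ) {w : ℂ}
    (hw : ‖w - f.eval z‖ ≤ 0.0825 * (‖f.derivative.eval z‖ / γ)) :
    let z' := z - (f.eval z - w) / f.derivative.eval z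
    γ * ‖z' - z‖ ≤ 0.0825 ∧ GammaBound f z' (1.5945 * γ) ∧
      ‖f.eval z' - w‖ ≤ 0.0158 * (‖f.derivative.eval z'‖ / (1.5945 * γ)) := by
  intro z'
  have hγ := hg.pos
  have hD := norm_pos_iff.2 hg.deriv_ne
  set D := f.derivative.eval z with hDdef
  set h := (w - f.eval z) / D with hh
  have hz' : z' = z + h := by
    simp only [z', hh]; ring
  have hnh : γ * ‖h‖ ≤ 0.0825 := by
    rw [hh, norm_div]
    calc γ * (‖w - f.eval z‖ / ‖D‖) ≤ γ * (0.0825 * (‖D‖ / γ) / ‖D‖) := by gcongr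
      _ = 0.0825 := by field_simp
  have hd : 0.81207 * ‖D‖ ≤ ‖f.derivative.eval z'‖ := by
    have h1 := hg.norm_derivative_sub_le (t := 0.0825) (by norm_num) hnh
    rw [← hz', ← hDdef] at h1
    have h2 := norm_sub_norm_le D (f.derivative.eval z')
    rw [norm_sub_rev] at h2
    have h3 : (1 / (1 - 0.0825) ^ 2 - 1 : ℝ) ≤ 0.18793 := by norm_num
    have h4 : ‖D‖ * (1 / (1 - 0.0825) ^ 2 - 1 : ℝ) ≤ ‖D‖ * 0.18793 := by gcongr
    linarith
  have hd0 : f.derivative.eval z' ≠ 0 := norm_pos_iff.1 (by linarith)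
  refine ⟨by rwa [hz', add_sub_cancel_left], ⟨hd0, by positivity, fun j hj => ?_⟩, ?_⟩
  · have h1 := hg.norm_taylor_add_coeff_le (t := 0.0825) (by norm_num) hnh hj
    rw [← hz', ← hDdef] at h1
    refine h1.trans ?_
    obtain ⟨i, rfl⟩ : ∃ i, j = i + 2 := ⟨j - 2, by omega⟩
    rw [show i + 2 - 1 = i + 1 by omega, mul_pow]
    -- The case j = 2 is decisive: 0.9175⁻³ / 0.81207 ≤ 1.5945. Each further power costs only
    -- 1/0.9175.
    have h5 : (1 / (1 - 0.0825) ^ (i + 2 + 1) : ℝ) ≤ 0.81207 * 1.5945 ^ (i + 1) := by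
      have h6 : (1 / (1 - 0.0825) : ℝ) ^ i ≤ 1.5945 ^ i :=
        pow_le_pow_left₀ (by norm_num) (by norm_num) i
      have h7 : (1 / (1 - 0.0825) : ℝ) ^ 3 ≤ 0.81207 * 1.5945 := by norm_num
      calc (1 / (1 - 0.0825) ^ (i + 2 + 1) : ℝ) =
          (1 / (1 - 0.0825)) ^ i * (1 / (1 - 0.0825)) ^ 3 := by
            rw [← pow_add, one_div_pow]
        _ ≤ 1.5945 ^ i * (0.81207 * 1.5945) := by gcongr
        _ = _ := by ring
    calc _ ≤ ‖D‖ * γ ^ (i + 1) * (0.81207 * 1.5945 ^ (i + 1)) := by gcongr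
      _ = (0.81207 * ‖D‖) * (1.5945 ^ (i + 1) * γ ^ (i + 1)) := by ring
      _ ≤ _ := by gcongr
  · have h1 := hg.norm_eval_sub_le (t := 0.0825) (by norm_num) hnh
    have e : f.eval (z + h) - f.eval z - D * h = f.eval z' - w := by
      rw [hz', hh, mul_div_cancel₀ _ hg.deriv_ne]; ring
    rw [e] at h1
    refine h1.trans ?_
    rw [← hDdef]
    calc ‖D‖ / γ * (0.0825 ^ 2 / (1 - 0.0825)) ≤ ‖D‖ / γ * (0.0158 * 0.81207 / 1.5945) :=
          mul_le_mul_of_nonneg_left (by norm_num) (by positivity)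
      _ = 0.0158 * ((0.81207 * ‖D‖) / (1.5945 * γ)) := by field_simp
      _ ≤ _ := by gcongr

end GammaBound

end AlphaStep

/-! ### Uniqueness and gluing of inverse branches -/

namespace AlphaStep
open Metric Set Filter Topology

variable {f : ℂ[X]}

namespace IsInverseBranch

theorem derivative_ne_zero {U : Set ℂ} {g : ℂ → ℂ} (h : IsInverseBranch f U g) {y : ℂ}
    (hy : y ∈ U) : f.derivative.eval (g y) ≠ 0 := by
  intro h0
  have hU := h.isOpen.mem_nhds hy
  have hc : HasDerivAt (fun x => f.eval (g x)) (f.derivative.eval (g y) * deriv g y) y :=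
    (f.hasDerivAt (g y)).comp y (h.differentiableOn.differentiableAt hU).hasDerivAt
  have hid : HasDerivAt (fun x => f.eval (g x)) 1 y := by
    refine (hasDerivAt_id y).congr_of_eventuallyEq ?_
    filter_upwards [hU] with x hx using h.eval_eq x hx
  have := hc.unique hid
  rw [h0, zero_mul] at this
  exact zero_ne_one this

theorem mono {U V : Set ℂ} {g : ℂ → ℂ} (h : IsInverseBranch f U g) (hV : IsOpen V)
    (hVU : V ⊆ U) : IsInverseBranch f V g :=
  ⟨hV, h.differentiableOn.mono hVU, fun y hy => h.eval_eq y (hVU hy)⟩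

/-- Two inverse branches that agree at a point agree on every connected set containing it. -/
theorem eqOn {U₁ U₂ S : Set ℂ} {g₁ g₂ : ℂ → ℂ} (h₁ : IsInverseBranch f U₁ g₁)
    (h₂ : IsInverseBranch f U₂ g₂) (hS : IsPreconnected S) (hS₁ : S ⊆ U₁) (hS₂ : S ⊆ U₂) {w : ℂ}
    (hw : w ∈ S) (heq : g₁ w = g₂ w) : EqOn g₁ g₂ S := by
  refine AnalyticOnNhd.eqOn_of_preconnected_of_eventuallyEq
    ((h₁.differentiableOn.analyticOnNhd h₁.isOpen).mono hS₁)
    ((h₂.differentiableOn.analyticOnNhd h₂.isOpen).mono hS₂) hS hw ?_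
  have hU₁ := h₁.isOpen.mem_nhds (hS₁ hw)
  have hU₂ := h₂.isOpen.mem_nhds (hS₂ hw)
  have hf := f.hasStrictDerivAt (g₁ w)
  -- Near w both branches must equal the local inverse of f at their common value; the identity
  -- theorem does the rest.
  have hl := HasStrictDerivAt.eventually_left_inverse hf (h₁.derivative_ne_zero (hS₁ hw))
  have c₁ : Tendsto g₁ (𝓝 w) (𝓝 (g₁ w)) :=
    (h₁.differentiableOn.differentiableAt hU₁).continuousAt
  have c₂ : Tendsto g₂ (𝓝 w) (𝓝 (g₁ w)) := by
    rw [heq]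
    exact (h₂.differentiableOn.differentiableAt hU₂).continuousAt
  filter_upwards [hU₁, hU₂, c₁.eventually hl, c₂.eventually hl] with y hy₁ hy₂ e₁ e₂
  rw [h₁.eval_eq y hy₁] at e₁
  rw [h₂.eval_eq y hy₂] at e₂
  exact e₁.symm.trans e₂

/-- Inverse branches on convex domains that agree at a common point can be glued. -/
theorem exists_glue {U₁ U₂ : Set ℂ} {g₁ g₂ : ℂ → ℂ} (h₁ : IsInverseBranch f U₁ g₁)
    (h₂ : IsInverseBranch f U₂ g₂) (c₁ : Convex ℝ U₁) (c₂ : Convex ℝ U₂) {w : ℂ}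
    (hw₁ : w ∈ U₁) (hw₂ : w ∈ U₂) (heq : g₁ w = g₂ w) :
    ∃ g, IsInverseBranch f (U₁ ∪ U₂) g ∧ EqOn g g₁ U₁ ∧ EqOn g g₂ U₂ := by
  classical
  have hag : EqOn g₁ g₂ (U₁ ∩ U₂) := h₁.eqOn h₂ (c₁.inter c₂).isPreconnected inter_subset_left
    inter_subset_right ⟨hw₁, hw₂⟩ heq
  have e₁ : EqOn (U₁.piecewise g₁ g₂) g₁ U₁ := fun x hx => piecewise_eq_of_mem _ _ _ hx
  have e₂ : EqOn (U₁.piecewise g₁ g₂) g₂ U₂ := by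
    intro x hx
    by_cases hx₁ : x ∈ U₁
    · rw [piecewise_eq_of_mem _ _ _ hx₁, hag ⟨hx₁, hx⟩]
    · rw [piecewise_eq_of_notMem _ _ _ hx₁]
  refine ⟨U₁.piecewise g₁ g₂, ⟨h₁.isOpen.union h₂.isOpen, ?_, ?_⟩, e₁, e₂⟩
  · exact (h₁.differentiableOn.congr e₁).union_of_isOpen (h₂.differentiableOn.congr e₂) h₁.isOpen
      h₂.isOpen
  · rintro y (hy | hy)
    · rw [e₁ hy, h₁.eval_eq y hy]
    · rw [e₂ hy, h₂.eval_eq y hy]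

/-- A branch near a segment can be glued to a branch on a convex set. -/
theorem exists_glue_segment {U V : Set ℂ} {g h : ℂ → ℂ} {a w : ℂ} (hg : IsInverseBranch f U g)
    (hh : IsInverseBranch f V h) (hU : segment ℝ a w ⊆ U) (hV : Convex ℝ V) (hw : w ∈ V)
    (heq : g w = h w) :
    ∃ W k, IsInverseBranch f W k ∧ segment ℝ a w ⊆ W ∧ V ⊆ W ∧ EqOn k g (segment ℝ a w) ∧
      EqOn k h V := by
  have hcomp : IsCompact (segment ℝ a w) := by
    rw [segment_eq_image_lineMap]
    exact isCompact_Icc.image AffineMap.lineMap_continuous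
  -- U need not be convex, but a thin neighborhood of the segment is, so the gluing of convex
  -- domains applies.
  obtain ⟨δ, hδ, hsub⟩ := hcomp.exists_thickening_subset_open hg.isOpen hU
  have hself := self_subset_thickening hδ (segment ℝ a w)
  obtain ⟨k, hk, k1, k2⟩ := (hg.mono isOpen_thickening hsub).exists_glue hh
    ((convex_segment a w).thickening δ) hV (hself (right_mem_segment ℝ a w)) hw heq
  exact ⟨_, k, hk, hself.trans subset_union_left, subset_union_right, k1.mono hself, k2⟩

/-- The disk is the increasing union of smaller ones, on which the branches agree by uniqueness; at
y the branch on radius (|y - w| + R)/2 is used. This is why the supremum of the radii is attained.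
-/
theorem exists_ball_of_forall_lt {w a : ℂ} {R : ℝ} (hR : 0 < R)
    (h : ∀ r, 0 < r → r < R → ∃ g, IsInverseBranch f (ball w r) g ∧ g w = a) :
    ∃ g, IsInverseBranch f (ball w R) g ∧ g w = a := by
  choose! G hG hGa using h
  let m : ℂ → ℝ := fun y => (dist y w + R) / 2
  have hm : ∀ y ∈ ball w R, 0 < m y ∧ m y < R ∧ dist y w < m y := by
    intro y hy
    have h1 := mem_ball.1 hy
    have h2 := dist_nonneg (x := y) (y := w)
    refine ⟨?_, ?_, ?_⟩ <;> simp only [m] <;> linarith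
  have hag : ∀ r s, 0 < r → r ≤ s → s < R → EqOn (G r) (G s) (ball w r) := by
    intro r s hr hrs hs
    exact (hG r hr (hrs.trans_lt hs)).eqOn (hG s (hr.trans_le hrs) hs)
      (convex_ball w r).isPreconnected subset_rfl (ball_subset_ball hrs) (mem_ball_self hr)
      ((hGa r hr (hrs.trans_lt hs)).trans (hGa s (hr.trans_le hrs) hs).symm)
  have hag' : ∀ r s y, 0 < r → r < R → 0 < s → s < R → dist y w < r → dist y w < s →
      G r y = G s y := by
    intro r s y hr hr' hs hs' h1 h2
    rcases le_total r s with hrs | hrs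
    · exact hag r s hr hrs hs' h1
    · exact (hag s r hs hrs hr' h2).symm
  have hloc : ∀ y₀ ∈ ball w R, EqOn (fun y => G (m y) y) (G (m y₀)) (ball w (m y₀)) := by
    intro y₀ hy₀ y hy
    obtain ⟨a1, a2, _⟩ := hm y₀ hy₀
    obtain ⟨b1, b2, b3⟩ := hm y ((mem_ball.1 hy).trans a2)
    exact hag' _ _ _ b1 b2 a1 a2 b3 hy
  refine ⟨fun y => G (m y) y, ⟨isOpen_ball, fun y hy => ?_, fun y hy => ?_⟩, ?_⟩
  · obtain ⟨a1, a2, a3⟩ := hm y hy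
    have hn : ball w (m y) ∈ 𝓝 y := isOpen_ball.mem_nhds a3
    have hd := (hG _ a1 a2).differentiableOn.differentiableAt hn
    refine (hd.congr_of_eventuallyEq ?_).differentiableWithinAt
    filter_upwards [hn] with x hx using hloc y hy hx
  · obtain ⟨a1, a2, a3⟩ := hm y hy
    exact (hG _ a1 a2).eval_eq y a3
  · obtain ⟨a1, a2, _⟩ := hm w (mem_ball_self hR)
    exact hGa _ a1 a2

end IsInverseBranch

/-- If the radii of univalence are bounded, then the largest one is attained. -/
theorem exists_isGreatest_univalenceRadii {z₀ w : ℂ} {U : Set ℂ} {g : ℂ → ℂ} {r₀ : ℝ}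
    (hg : IsInverseBranch f U g) (hU : segment ℝ (f.eval z₀) w ⊆ U) (hr₀ : 0 < r₀)
    (hball : ball w r₀ ⊆ U) (hgz : g (f.eval z₀) = z₀)
    (hbdd : BddAbove (univalenceRadii f z₀ w)) :
    ∃ R, IsGreatest (univalenceRadii f z₀ w) R ∧ 0 < R := by
  have hmem : r₀ ∈ univalenceRadii f z₀ w := ⟨hr₀.le, U, g, hg, hU, hball, hgz⟩
  set R := sSup (univalenceRadii f z₀ w) with hRdef
  have hR : 0 < R := hr₀.trans_le (le_csSup hbdd hmem)
  have hall : ∀ r, 0 < r → r < R → ∃ h, IsInverseBranch f (ball w r) h ∧ h w = g w := by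
    intro r _ hrR
    obtain ⟨s, ⟨_, V, h, hh, hV, hsV, hhz⟩, hrs⟩ := exists_lt_of_lt_csSup ⟨r₀, hmem⟩ hrR
    refine ⟨h, hh.mono isOpen_ball ((ball_subset_ball hrs.le).trans hsV), ?_⟩
    exact hh.eqOn hg (convex_segment _ _).isPreconnected hV hU (left_mem_segment ℝ _ _)
      (hhz.trans hgz.symm) (right_mem_segment ℝ _ _)
  obtain ⟨h, hh, hhw⟩ := IsInverseBranch.exists_ball_of_forall_lt hR hall
  obtain ⟨W, k, hk, hkW, hbW, kg, _⟩ := hg.exists_glue_segment hh hU (convex_ball w R)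
    (mem_ball_self hR) hhw.symm
  refine ⟨R, ⟨⟨hR.le, W, k, hk, hkW, hbW, ?_⟩, fun r hr => le_csSup hbdd hr⟩, hR⟩
  rw [kg (left_mem_segment ℝ _ _), hgz]

/-- All guide points lie on one ray from w₀, so the segment to the next one is the old segment
followed by the new jump. -/
theorem segment_sub_smul_eq_union (w u : ℂ) {s t : ℝ} (hs : 0 ≤ s) (ht : 0 ≤ t) :
    segment ℝ w (w - ((s + t : ℝ) : ℂ) * u) =
      segment ℝ w (w - (s : ℂ) * u) ∪ segment ℝ (w - (s : ℂ) * u) (w - ((s + t : ℝ) : ℂ) * u) := by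
  let L : ℝ →ᵃ[ℝ] ℂ := AffineMap.lineMap w (w - u)
  have hL : ∀ r : ℝ, L r = w - (r : ℂ) * u := by
    intro r
    simp only [L, AffineMap.lineMap_apply_module']
    simp
    ring
  have h0 : L 0 = w := by rw [hL]; simp
  have key : ∀ a b : ℝ, a ≤ b → segment ℝ (L a) (L b) = L '' Icc a b := by
    intro a b hab
    rw [← segment_eq_Icc hab, image_segment]
  have key₀ : ∀ b : ℝ, 0 ≤ b → segment ℝ w (L b) = L '' Icc 0 b := by
    intro b hb
    rw [← key 0 b hb, h0]
  rw [← hL, ← hL, key₀ _ (by positivity), key₀ _ hs, key _ _ (by linarith), ← image_union,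
    Icc_union_Icc_eq_Icc hs (by linarith)]

end AlphaStep

/-! ### The invariant of the algorithm and the main result -/

namespace AlphaStep
open Metric Set Filter Topology

variable {f : ℂ[X]} {z₀ u z w : ℂ}

/-- The point `z` approximates the value at `w` of the inverse branch continued from `f z₀` along
the segment in direction `-u`. -/
def Tracks (f : ℂ[X]) (z₀ u z w : ℂ) : Prop :=
  ∃ (γ s : ℝ) (U : Set ℂ) (g : ℂ → ℂ), GammaBound f z γ ∧
    ‖f.eval z - w‖ ≤ 0.0158 * (‖f.derivative.eval z‖ / γ) ∧
    0 ≤ s ∧ w = f.eval z₀ - (s : ℂ) * u ∧ IsInverseBranch f U g ∧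
    segment ℝ (f.eval z₀) w ⊆ U ∧ g (f.eval z₀) = z₀ ∧ g w ∈ ball z (0.29 / γ)

/-- Some admissible γ is taken instead of the optimal one because α(z₀) may be 0, as happens for d =
1. -/
theorem tracks_start (f : ℂ[X]) {z₀ : ℂ} (u : ℂ) (hf' : f.derivative.eval z₀ ≠ 0) :
    Tracks f z₀ u z₀ (f.eval z₀) := by
  obtain ⟨γ, hγ⟩ := exists_gammaBound hf'
  obtain ⟨g, hg, hmaps⟩ := hγ.exists_branch
  have hρ : 0 < ‖f.derivative.eval z₀‖ / γ := div_pos (norm_pos_iff.2 hf') hγ.pos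
  have hmem : f.eval z₀ ∈ ball (f.eval z₀) (0.0857 * (‖f.derivative.eval z₀‖ / γ)) :=
    mem_ball_self (by positivity)
  have hz₀ : z₀ ∈ ball z₀ (0.29 / γ) := mem_ball_self (div_pos (by norm_num) hγ.pos)
  refine ⟨γ, 0, _, g, hγ, ?_, le_rfl, by simp, hg, ?_, ?_, hmaps hmem⟩
  · rw [sub_self, norm_zero]; positivity
  · rw [segment_same]; exact singleton_subset_iff.2 hmem
  · exact hγ.injOn_ball (hmaps hmem) hz₀ (hg.eval_eq _ hmem)

theorem Tracks.derivative_ne_zero (h : Tracks f z₀ u z w) : f.derivative.eval z ≠ 0 := by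
  obtain ⟨γ, s, U, g, hγ, -⟩ := h
  exact hγ.deriv_ne

theorem div_alpha_eq (hf' : f.derivative.eval z ≠ 0) (hα : 0 < alpha f z) :
    ‖f.derivative.eval z‖ / (alpha f z * ‖f.derivative.eval z‖ / ‖f.eval z‖) =
      ‖f.eval z‖ / alpha f z := by
  have hD := norm_pos_iff.2 hf'
  have hF := norm_pos_iff.2 (gammaBound_of_alpha_pos hf' hα).1
  field_simp

/-- The γ stored in the invariant is only an upper bound for Smale's number, so |f'|/γ ≤ |f|/α. -/
theorem Tracks.norm_residual_le (h : Tracks f z₀ u z w) (hα : 0 < alpha f z) :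
    ‖f.eval z - w‖ ≤ 0.0158 * (‖f.eval z‖ / alpha f z) := by
  obtain ⟨γ, s, U, g, hγ, herr, -⟩ := h
  refine herr.trans ?_
  gcongr 0.0158 * ?_
  have h1 := hγ.alpha_le
  have hD := norm_pos_iff.2 hγ.deriv_ne
  rw [norm_div, div_mul_eq_mul_div, le_div_iff₀ hD] at h1
  rw [div_le_div_iff₀ hγ.pos hα]
  linarith

/-- The continued branch is defined on an explicit disk around `f z`, where its values lie in a disk
around `z` on which `f` is injective. -/
theorem Tracks.exists_branch (h : Tracks f z₀ u z w) (hα : 0 < alpha f z) :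
    ∃ (γ : ℝ) (U : Set ℂ) (g : ℂ → ℂ), GammaBound f z γ ∧
      ‖f.derivative.eval z‖ / γ = ‖f.eval z‖ / alpha f z ∧ IsInverseBranch f U g ∧
      segment ℝ (f.eval z₀) w ⊆ U ∧ ball (f.eval z) (0.0857 * (‖f.eval z‖ / alpha f z)) ⊆ U ∧
      g (f.eval z₀) = z₀ ∧
      MapsTo g (ball (f.eval z) (0.0857 * (‖f.eval z‖ / alpha f z))) (ball z (0.29 / γ)) := by
  have herr := h.norm_residual_le hα
  obtain ⟨γ', s, U, g, hγ', -, hs, hw, hg, hU, hgz, hgw⟩ := h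
  have hf' := hγ'.deriv_ne
  obtain ⟨hf, hγ⟩ := gammaBound_of_alpha_pos hf' hα
  have hρ := div_alpha_eq hf' hα
  have hγγ : alpha f z * ‖f.derivative.eval z‖ / ‖f.eval z‖ ≤ γ' := by
    have h1 := hγ'.alpha_le
    have hD := norm_pos_iff.2 hf'
    rw [norm_div, div_mul_eq_mul_div, le_div_iff₀ hD] at h1
    rw [div_le_iff₀ (norm_pos_iff.2 hf)]
    linarith
  set γ := alpha f z * ‖f.derivative.eval z‖ / ‖f.eval z‖
  obtain ⟨k, hk, hmaps⟩ := hγ.exists_branch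
  rw [hρ] at hk hmaps
  have hρ0 : 0 < ‖f.eval z‖ / alpha f z := div_pos (norm_pos_iff.2 hf) hα
  have hwB : w ∈ ball (f.eval z) (0.0857 * (‖f.eval z‖ / alpha f z)) := by
    rw [mem_ball, dist_comm, dist_eq_norm]
    linarith
  -- Passing to the optimal, smaller γ enlarges the disk of injectivity, which then identifies g(w)
  -- with the value of the local inverse.
  have hgw' : g w ∈ ball z (0.29 / γ) :=
    ball_subset_ball (div_le_div_of_nonneg_left (by norm_num) hγ.pos hγγ) hgw
  have heq : g w = k w := by
    refine hγ.injOn_ball hgw' (hmaps hwB) ?_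
    simp only
    rw [hg.eval_eq w (hU (right_mem_segment ℝ _ _)), hk.eval_eq w hwB]
  obtain ⟨V, l, hl, hsV, hbV, lg, lk⟩ := hg.exists_glue_segment hk hU (convex_ball _ _) hwB heq
  refine ⟨γ, V, l, hγ, hρ, hl, hsV, hbV, ?_, fun y hy => ?_⟩
  · rw [lg (left_mem_segment ℝ _ _), hgz]
  · rw [lk hy]; exact hmaps hy

/-- Upper bound for the radii of univalence, from Koebe's theorem. -/
theorem Tracks.le_of_mem_univalenceRadii (h : Tracks f z₀ u z w) (hα : 0 < alpha f z) {r : ℝ}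
    (hr : r ∈ univalenceRadii f z₀ w) : r ≤ 4.4 * (‖f.eval z‖ / alpha f z) := by
  have herr := h.norm_residual_le hα
  have hf' := h.derivative_ne_zero
  obtain ⟨γ, U, g, hγ, -, hg, hU, hB, hgz, hmaps⟩ := h.exists_branch hα
  obtain ⟨-, V, k, hk, hV, hrV, hkz⟩ := hr
  have hf := (gammaBound_of_alpha_pos hf' hα).1
  have hD := norm_pos_iff.2 hf'
  have hF := norm_pos_iff.2 hf
  set ρ := ‖f.eval z‖ / alpha f z with hρ
  have hρ0 : 0 < ρ := div_pos hF hα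
  by_contra! hlt
  have hδ : ‖f.eval z - w‖ < r := by linarith
  set B := ball (f.eval z) (0.0857 * ρ) with hBdef
  have hwB : w ∈ B := by
    rw [hBdef, mem_ball, dist_comm, dist_eq_norm]
    linarith
  have hzB : f.eval z ∈ B := mem_ball_self (by positivity)
  have hzr : f.eval z ∈ ball w r := by rwa [mem_ball, dist_eq_norm]
  have hkgw : k w = g w := hk.eqOn hg (convex_segment _ _).isPreconnected hV hU
    (left_mem_segment ℝ _ _) (hkz.trans hgz.symm) (right_mem_segment ℝ _ _)
  have hkg : k (f.eval z) = g (f.eval z) := by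
    refine hk.eqOn hg ((convex_ball w r).inter (convex_ball _ (0.0857 * ρ))).isPreconnected
      (inter_subset_left.trans hrV) (inter_subset_right.trans hB) (w := w)
      ⟨mem_ball_self ((norm_nonneg _).trans_lt hδ), hwB⟩ hkgw ⟨hzr, hzB⟩
  have hgz' : g (f.eval z) = z :=
    hγ.injOn_ball (hmaps hzB) (mem_ball_self (div_pos (by norm_num) hγ.pos))
      (hg.eval_eq _ (hB hzB))
  have hR : 0 < r - ‖f.eval z - w‖ := by linarith
  have hsub : ball (f.eval z) (r - ‖f.eval z - w‖) ⊆ V := by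
    refine Subset.trans (ball_subset_ball' ?_) hrV
    rw [dist_eq_norm]; linarith
  -- The branch passes through z and is defined on the disk of radius r - δ around f(z), so the
  -- coefficient bounds give r - δ ≤ 4ρ.
  have h1 := alpha_le (f := f) (z := z) (A := 4 * ‖f.derivative.eval z‖ / (r - ‖f.eval z - w‖))
    (by positivity) fun j hj =>
      norm_taylor_coeff_le_of_branch hR (hk.differentiableOn.mono hsub) (hkg.trans hgz')
        (fun y hy => hk.eval_eq y (hsub hy)) hf' hj
  have h2 : alpha f z ≤ 4 * ‖f.eval z‖ / (r - ‖f.eval z - w‖) := by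
    refine h1.trans_eq ?_
    rw [norm_div]
    field_simp
  rw [le_div_iff₀ hR, mul_comm, ← le_div_iff₀ hα, mul_div_assoc, ← hρ] at h2
  linarith

/-- One step of the algorithm. -/
theorem Tracks.step (h : Tracks f z₀ u z w) (hα : 0 < alpha f z) (hu : ‖u‖ = 1) :
    let w' := w - ((1 / 15 * (‖f.eval z‖ / alpha f z) : ℝ) : ℂ) * u
    Tracks f z₀ u (z - (f.eval z - w') / f.derivative.eval z) w' := by
  intro w'
  have herr := h.norm_residual_le hα
  have hf' := h.derivative_ne_zero
  obtain ⟨γ, U, g, hγ, hργ, hg, hU, hB, hgz, hmaps⟩ := h.exists_branch hα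
  obtain ⟨-, s, -, -, -, -, hs, hw, -⟩ := h
  have hf := (gammaBound_of_alpha_pos hf' hα).1
  set ρ := ‖f.eval z‖ / alpha f z with hρ
  have hρ0 : 0 < ρ := div_pos (norm_pos_iff.2 hf) hα
  have hγ0 := hγ.pos
  have hw' : w' = w - ((1 / 15 * ρ : ℝ) : ℂ) * u := rfl
  have hw'eq : w' = f.eval z₀ - ((s + 1 / 15 * ρ : ℝ) : ℂ) * u := by
    rw [hw', hw]
    push_cast
    ring
  have hww : ‖w' - w‖ = 1 / 15 * ρ := by
    have : w' - w = -(((1 / 15 * ρ : ℝ) : ℂ) * u) := by rw [hw']; ring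
    rw [this, norm_neg, norm_mul, hu, mul_one, Complex.norm_real,
      Real.norm_of_nonneg (by positivity)]
  -- The jump and the old residual add up to 1/15 + 0.0158 < 0.0825.
  have hw'f : ‖w' - f.eval z‖ ≤ 0.0825 * ρ := by
    have e : w' - f.eval z = (w' - w) - (f.eval z - w) := by ring
    have h1 := norm_sub_le (w' - w) (f.eval z - w)
    rw [← e, hww] at h1
    linarith
  have hwB : w ∈ ball (f.eval z) (0.0857 * ρ) := by
    rw [mem_ball, dist_comm, dist_eq_norm]
    linarith
  have hw'B : w' ∈ ball (f.eval z) (0.0857 * ρ) := by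
    rw [mem_ball, dist_eq_norm]
    linarith
  have hgw' : f.eval (g w') = w' := hg.eval_eq _ (hB hw'B)
  have hloc : γ * ‖g w' - z‖ < 0.0925 := by
    refine hγ.norm_sub_lt_of_norm_eval_sub_lt (hmaps hw'B) ?_
    rwa [hgw', hργ]
  rw [← hργ] at hw'f
  obtain ⟨hz1, hγ1, herr1⟩ := hγ.newton_step hw'f
  set z' := z - (f.eval z - w') / f.derivative.eval z
  refine ⟨1.5945 * γ, s + 1 / 15 * ρ, U, g, hγ1, herr1, by positivity, hw'eq, hg, ?_, hgz, ?_⟩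
  · rw [hw'eq, segment_sub_smul_eq_union _ _ hs (by positivity), ← hw'eq, ← hw]
    exact union_subset hU (((convex_ball _ _).segment_subset hwB hw'B).trans hB)
  · rw [mem_ball, dist_eq_norm, lt_div_iff₀ hγ1.pos]
    have h1 : ‖g w' - z'‖ ≤ ‖g w' - z‖ + ‖z' - z‖ := by
      have : g w' - z' = (g w' - z) - (z' - z) := by ring
      rw [this]; exact norm_sub_le _ _
    -- 0.0925 + 0.0825 = 0.175, which is below the new injectivity radius 0.29/1.5945 in units of
    -- 1/γ.
    have h2 : γ * ‖g w' - z'‖ ≤ 0.175 :=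
      calc γ * ‖g w' - z'‖ ≤ γ * (‖g w' - z‖ + ‖z' - z‖) := by gcongr
        _ ≤ 0.175 := by linarith
    linarith

theorem guide_succ (f : ℂ[X]) (z₀ : ℂ) (n : ℕ) :
    guide f z₀ (n + 1) = guide f z₀ n -
      ((1 / 15 * (‖f.eval (point f z₀ n)‖ / alpha f (point f z₀ n)) : ℝ) : ℂ) *
        (f.eval z₀ / (‖f.eval z₀‖ : ℂ)) := by
  simp only [guide, point, iter, Function.iterate_succ_apply']
  rfl

theorem point_succ (f : ℂ[X]) (z₀ : ℂ) (n : ℕ) :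
    point f z₀ (n + 1) = point f z₀ n -
      (f.eval (point f z₀ n) - guide f z₀ (n + 1)) / f.derivative.eval (point f z₀ n) := by
  simp only [guide, point, iter, Function.iterate_succ_apply']
  rfl

/-- The stopping threshold enters only through α > 0, which makes each step well defined. -/
theorem tracks_of_reaches (hf : f.eval z₀ ≠ 0) (hf' : f.derivative.eval z₀ ≠ 0) {n : ℕ}
    (hn : Reaches f z₀ n) :
    Tracks f z₀ (f.eval z₀ / (‖f.eval z₀‖ : ℂ)) (point f z₀ n) (guide f z₀ n) := by
  induction n with
  | zero => exact tracks_start f _ hf'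
  | succ n ih =>
    have hα : 0 < alpha f (point f z₀ n) :=
      lt_trans (by norm_num) (show 0.1307 < alpha f (point f z₀ n) from hn n n.lt_succ_self)
    have hu : ‖f.eval z₀ / (‖f.eval z₀‖ : ℂ)‖ = 1 := by
      rw [norm_div, Complex.norm_real, norm_norm, div_self (norm_ne_zero_iff.2 hf)]
    have h := (ih fun k hk => hn k (hk.trans n.lt_succ_self)).step hα hu
    rw [point_succ, guide_succ]
    exact h

theorem eval_ne_zero_of_one_le_norm {d : ℕ} {ζ : Fin d → ℂ} (hζ : ∀ j, ‖ζ j‖ < 1) (hz : 1 ≤ ‖z‖) :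
    (∏ j, (X - C (ζ j))).eval z ≠ 0 := by
  rw [eval_prod, Finset.prod_ne_zero_iff]
  intro j _ h
  rw [eval_sub, eval_X, eval_C, sub_eq_zero] at h
  rw [h] at hz
  linarith [hζ j]

/-- Gauss–Lucas: the critical points lie in the convex hull of the zeros, hence in the open unit
disk. -/
theorem derivative_eval_ne_zero_of_one_le_norm {d : ℕ} (hd : 1 ≤ d) {ζ : Fin d → ℂ}
    (hζ : ∀ j, ‖ζ j‖ < 1) (hz : 1 ≤ ‖z‖) : (derivative (∏ j, (X - C (ζ j)))).eval z ≠ 0 := by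
  intro h
  set P : ℂ[X] := ∏ j, (X - C (ζ j)) with hP
  have hdeg : P.natDegree = d := by
    rw [hP, natDegree_prod_of_monic _ _ fun j _ => monic_X_sub_C _]
    simp
  have hpos : 0 < P.degree := natDegree_pos_iff_degree_pos.1 (by omega)
  have hder : derivative P ≠ 0 := fun h0 => by
    have := Polynomial.derivative_eq_zero.1 h0
    omega
  have hmem : z ∈ (derivative P).rootSet ℂ := by
    rw [mem_rootSet, coe_aeval_eq_eval]
    exact ⟨hder, h⟩
  have hsub : P.rootSet ℂ ⊆ ball 0 1 := by
    intro x hx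
    rw [mem_rootSet, coe_aeval_eq_eval] at hx
    by_contra hx1
    exact eval_ne_zero_of_one_le_norm hζ (by simpa using hx1) hx.2
  have := convexHull_min hsub (convex_ball 0 1)
    (rootSet_derivative_subset_convexHull_rootSet hpos hmem)
  rw [mem_ball, dist_zero_right] at this
  linarith

end AlphaStep

theorem proposition6p1 (d : ℕ) (hd : 1 ≤ d) (ζ : Fin d → ℂ) (hζ : Function.Injective ζ)
    (hζ1 : ∀ j, ‖ζ j‖ < 1) (f : Polynomial ℂ)
    (hf : f = ∏ j, (Polynomial.X - Polynomial.C (ζ j)))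
    (z₀ : ℂ) (hz₀ : ‖z₀‖ = 1 + 1 / (d : ℝ)) (n : ℕ) (hn : AlphaStep.Reaches f z₀ n) :
    (Polynomial.derivative f).eval (AlphaStep.point f z₀ n) ≠ 0 ∧
    (AlphaStep.Continues f z₀ n →
      (∃ r : ℝ,
        IsGreatest (AlphaStep.univalenceRadii f z₀ (AlphaStep.guide f z₀ n)) r ∧
        0 < r ∧ AlphaStep.jump f z₀ n ≥ r / 66) ∧
      AlphaStep.err f z₀ n ≤
        0.0158 * (‖f.eval (AlphaStep.point f z₀ n)‖ /
          AlphaStep.alpha f (AlphaStep.point f z₀ n))) := by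
  have hz1 : 1 ≤ ‖z₀‖ := by
    rw [hz₀]
    linarith [show (0 : ℝ) ≤ 1 / (d : ℝ) by positivity]
  have hf0 : f.eval z₀ ≠ 0 := by
    rw [hf]; exact AlphaStep.eval_ne_zero_of_one_le_norm hζ1 hz1
  have hf' : (Polynomial.derivative f).eval z₀ ≠ 0 := by
    rw [hf]; exact AlphaStep.derivative_eval_ne_zero_of_one_le_norm hd hζ1 hz1
  have ht := AlphaStep.tracks_of_reaches hf0 hf' hn
  refine ⟨ht.derivative_ne_zero, fun hc => ?_⟩
  have hα : 0 < AlphaStep.alpha f (AlphaStep.point f z₀ n) :=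
    lt_trans (by norm_num) (show 0.1307 < AlphaStep.alpha f (AlphaStep.point f z₀ n) from hc)
  have herr := ht.norm_residual_le hα
  refine ⟨?_, herr⟩
  have hbound := fun r => ht.le_of_mem_univalenceRadii hα (r := r)
  obtain ⟨γ, U, g, -, -, hg, hU, hB, hgz, -⟩ := ht.exists_branch hα
  have hρ : 0 < ‖f.eval (AlphaStep.point f z₀ n)‖ / AlphaStep.alpha f (AlphaStep.point f z₀ n) :=
    div_pos (norm_pos_iff.2 (AlphaStep.gammaBound_of_alpha_pos ht.derivative_ne_zero hα).1) hα
  have hjump : AlphaStep.jump f z₀ n = 1 / 15 *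
      (‖f.eval (AlphaStep.point f z₀ n)‖ / AlphaStep.alpha f (AlphaStep.point f z₀ n)) := by
    rw [AlphaStep.jump, AlphaStep.guide_succ, sub_sub_cancel, norm_mul, Complex.norm_real,
      norm_div, Complex.norm_real, norm_norm, div_self (norm_ne_zero_iff.2 hf0), mul_one,
      Real.norm_of_nonneg (by positivity)]
  -- 0.0699 = 0.0857 - 0.0158: a disk around w_n inside the disk around f(z_n) where the branch is
  -- defined.
  obtain ⟨R, hR, hR0⟩ := AlphaStep.exists_isGreatest_univalenceRadii hg hU
    (r₀ := 0.0699 * (‖f.eval (AlphaStep.point f z₀ n)‖ /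
      AlphaStep.alpha f (AlphaStep.point f z₀ n))) (by positivity)
    ((Metric.ball_subset_ball' (by rw [dist_comm, dist_eq_norm]; linarith)).trans hB) hgz
    ⟨_, hbound⟩
  refine ⟨R, hR, hR0, ?_⟩
  -- 66/15 = 4.4, so the jump ρ/15 is at least R/66.
  have := hbound R hR.1
  rw [hjump]
  linarith
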